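/- Let $p$ be an odd prime and let $T$ be the $p$-regular rooted tree, whose vertices are the finite words over $\{1,\dots,p\}$ (the root is the empty word and the children of $v$ are the words $vx$ with $x\in\{1,\dots,p\}$). For $g\in\mathrm{Aut}(T)$ and a vertex $v$, the section $\varphi_v(g)\in\mathrm{Aut}(T)$ is defined by $g(vw)=g(v)\,\varphi_v(g)(w)$ for all words $w$. For $H\le\mathrm{Aut}(T)$, the section of $H$ at $v$ is the subgroup $\varphi_v(\mathrm{Stab}_H(v))$, and $\mathrm{Stab}_H(\mathcal L_1)$ denotes the pointwise stabiliser in $H$ of the first level $\mathcal L_1$. A group $G\le\mathrm{Aut}(T)$ is self-similar if $\varphi_v(\mathrm{Stab}_G(v))\le G$ for every vertex $v$. Let $G\le\mathrm{Aut}(T)$ be self-similar. A class $\mathcal X$ of subgroups of $G$ is weakly inductive if (A) $\{1\}\in\mathcal X$ and $G\in\mathcal X$; (B$'$) whenever $H\le L\le G$ with $[L:H]$ finite and $H\in\mathcal X$, then $L\in\mathcal X$; (C) whenever $H$ is a finitely generated subgroup of $\mathrm{Stab}_G(\mathcal L_1)$ and $\varphi_v(H)\in\mathcal X$ for every $v\in\mathcal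 L_1$, then $H\in\mathcal X$. It is inductive if moreover, whenever $H\le L\le G$ with $[L:H]$ finite and $L\in\mathcal X$, then $H\in\mathcal X$. The group $G$ has the strong subgroup induction property (respectively, the subgroup induction property) if every finitely generated subgroup of $G$ belongs to every weakly inductive (respectively, every inductive) class of subgroups of $G$. For a non-zero vector $\mathbf e=(e_0,\dots,e_{p-2})\in(\mathbf F_p)^{p-1}$, the GGS group with defining vector $\mathbf e$ is $G_{\mathbf e}=\langle a,b\rangle\le\mathrm{Aut}(T)$, where $a$ permutes the $p$ subtrees below the root rigidly according to the cycle $(1\,2\,\dots\,p)$, and $b$ fixes the first level and is defined recursively by its first-level sections $b=(a^{e_0},\dots,a^{e_{p-2}},b)$. Theorem. Let $G=G_{\mathbf e}$ be a GGS group acting on the $p$-regular rooted tree, with $p$ an odd prime and $\mathbf e\ne 0$. If $G$ is a torsion group, then $G$ is self-similar and has the strong subgroup induction property: for every weakly inductive class $\mathcal X$ of subgroups of $G$, every finitely generated subgroup of $G$ belongs to $\mathcal X$. In particular, $G$ has the subgroup induction property. -/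

import Mathlib

/-!
The regular rooted tree on an alphabet `X` is the set `List X` of finite words: the root is `[]`,
the children of `v` are the words `v ++ [x]`, and `w` lies below `v` iff `v` is a prefix of `w`.
-/

/-- Automorphisms of the rooted tree `List X`: the bijections of the vertex set that preserve and
reflect the prefix order, with composition `(g * h) v = g (h v)`. -/
abbrev TreeAut (X : Type*) : Type _ :=
  (List.IsPrefix : List X → List X → Prop) ≃r (List.IsPrefix : List X → List X → Prop)

namespace TreeAut

variable {X : Type*}

theorem prefix_iff (g : TreeAut X) {u v : List X} : g u <+: g v ↔ u <+: v := g.map_rel_iff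

theorem length_le (g : TreeAut X) (v : List X) : v.length ≤ (g v).length := by
  induction v using List.reverseRecOn with
  | nil => simp
  | append_singleton v x ih =>
    have h1 : g v <+: g (v ++ [x]) := g.prefix_iff.2 (List.prefix_append _ _)
    have h2 : g v ≠ g (v ++ [x]) := fun h => by simpa using g.injective h
    have h3 : (g v).length ≠ (g (v ++ [x])).length := fun h => h2 (h1.eq_of_length h)
    have h4 := h1.length_le
    simp only [List.length_append, List.length_singleton]
    omega

theorem length_apply (g : TreeAut X) (v : List X) : (g v).length = v.length := by
  refine le_antisymm ?_ (g.length_le v)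
  have h := TreeAut.length_le (g⁻¹ : TreeAut X) (g v)
  rwa [← RelIso.mul_apply, inv_mul_cancel, RelIso.one_apply] at h

/-- The action of the section of `g` at `v`, as a map on vertices: delete the prefix `g v`
from `g (v ++ w)`. -/
def sectionFun (g : TreeAut X) (v w : List X) : List X := (g (v ++ w)).drop v.length

theorem apply_append_eq (g : TreeAut X) (v w : List X) :
    g (v ++ w) = g v ++ sectionFun g v w := by
  obtain ⟨t, ht⟩ : g v <+: g (v ++ w) := g.prefix_iff.2 (List.prefix_append _ _)
  rw [sectionFun, ← ht, ← g.length_apply v, List.drop_left]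

theorem sectionFun_mul (g h : TreeAut X) (v w : List X) :
    sectionFun (g * h) v w = sectionFun g (h v) (sectionFun h v w) := by
  have h1 := apply_append_eq (g * h) v w
  rw [RelIso.mul_apply, RelIso.mul_apply, apply_append_eq h, apply_append_eq g] at h1
  exact (List.append_cancel_left h1).symm

theorem sectionFun_one (v w : List X) : sectionFun (1 : TreeAut X) v w = w := by
  simp [sectionFun]

/-- The section `φ_v(g) = g|_v` of `g` at the vertex `v`: the automorphism characterised by
`g (v ++ w) = g v ++ (g|_v) w` for all `w`. -/
def sec (v : List X) (g : TreeAut X) : TreeAut X where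
  toFun := sectionFun g v
  invFun := sectionFun g⁻¹ (g v)
  left_inv w := by rw [← sectionFun_mul, inv_mul_cancel, sectionFun_one]
  right_inv w := by
    have h : v = g⁻¹ (g v) := by rw [← RelIso.mul_apply, inv_mul_cancel, RelIso.one_apply]
    conv_lhs => enter [2]; rw [h]
    rw [← sectionFun_mul, mul_inv_cancel, sectionFun_one]
  map_rel_iff' {u w} := by
    change sectionFun g v u <+: sectionFun g v w ↔ u <+: w
    rw [← List.prefix_append_right_inj (g v), ← apply_append_eq, ← apply_append_eq, prefix_iff,
      List.prefix_append_right_inj]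

theorem apply_append (g : TreeAut X) (v w : List X) : g (v ++ w) = g v ++ sec v g w :=
  apply_append_eq g v w

theorem sec_mul (v : List X) (g h : TreeAut X) : sec v (g * h) = sec (h v) g * sec v h :=
  RelIso.ext fun w => sectionFun_mul g h v w

theorem sec_one (v : List X) : sec v (1 : TreeAut X) = 1 :=
  RelIso.ext fun w => sectionFun_one v w

/-- The pointwise stabiliser in `Aut T` of the `n`-th level of the tree. -/
def levelStab (X : Type*) (n : ℕ) : Subgroup (TreeAut X) where
  carrier := {g | ∀ v : List X, v.length = n → g v = v}
  one_mem' v _ := rfl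
  mul_mem' {g h} hg hh v hv := by rw [RelIso.mul_apply, hh v hv, hg v hv]
  inv_mem' {g} hg v hv := by
    conv_lhs => rw [← hg v hv]
    rw [← RelIso.mul_apply, inv_mul_cancel, RelIso.one_apply]

/-- The section `φ_v(Stab_H(v))` of a subgroup `H` of `Aut T` at the vertex `v`. -/
def secSubgroup (H : Subgroup (TreeAut X)) (v : List X) : Subgroup (TreeAut X) where
  carrier := {k | ∃ g ∈ H, g v = v ∧ sec v g = k}
  one_mem' := ⟨1, H.one_mem, rfl, sec_one v⟩
  mul_mem' := by
    rintro _ _ ⟨g, hg, hgv, rfl⟩ ⟨h, hh, hhv, rfl⟩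
    exact ⟨g * h, H.mul_mem hg hh, by rw [RelIso.mul_apply, hhv, hgv], by rw [sec_mul, hhv]⟩
  inv_mem' := by
    rintro _ ⟨g, hg, hgv, rfl⟩
    have hv : g⁻¹ v = v := by
      conv_lhs => rw [← hgv]
      rw [← RelIso.mul_apply, inv_mul_cancel, RelIso.one_apply]
    refine ⟨g⁻¹, H.inv_mem hg, hv, eq_inv_of_mul_eq_one_left ?_⟩
    have h := sec_mul v g⁻¹ g
    rw [inv_mul_cancel, sec_one, hgv] at h
    exact h.symm

/-- `G ≤ Aut T` is self-similar if every section `φ_v(Stab_G(v))` is contained in `G`. -/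
def IsSelfSimilar (G : Subgroup (TreeAut X)) : Prop :=
  ∀ v : List X, secSubgroup G v ≤ G

/-- Weakly inductive classes of subgroups of `G`. -/
structure IsWeaklyInductive (G : Subgroup (TreeAut X)) (𝒳 : Set (Subgroup (TreeAut X))) :
    Prop where
  /-- `𝒳` consists of subgroups of `G`. -/
  le : ∀ H ∈ 𝒳, H ≤ G
  bot_mem : ⊥ ∈ 𝒳
  self_mem : G ∈ 𝒳
  /-- If `H ≤ L ≤ G` with `[L : H]` finite and `H ∈ 𝒳`, then `L ∈ 𝒳`. -/
  mem_of_finite_index : ∀ H L : Subgroup (TreeAut X), H ≤ L → L ≤ G → H.IsFiniteRelIndex L →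
    H ∈ 𝒳 → L ∈ 𝒳
  /-- A finitely generated subgroup of `Stab_G(level 1)` all of whose first-level sections are
  in `𝒳` is itself in `𝒳`. -/
  mem_of_sections : ∀ H : Subgroup (TreeAut X), H.FG → H ≤ G ⊓ levelStab X 1 →
    (∀ x : X, secSubgroup H [x] ∈ 𝒳) → H ∈ 𝒳

/-- Inductive classes of subgroups of `G`: membership passes both up and down along
inclusions of finite index. -/
structure IsInductive (G : Subgroup (TreeAut X)) (𝒳 : Set (Subgroup (TreeAut X))) : Prop
    extends IsWeaklyInductive G 𝒳 where
  /-- If `H ≤ L ≤ G` with `[L : H]` finite and `L ∈ 𝒳`, then `H ∈ 𝒳`. -/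
  mem_of_finite_index_of_mem : ∀ H L : Subgroup (TreeAut X), H ≤ L → L ≤ G →
    H.IsFiniteRelIndex L → L ∈ 𝒳 → H ∈ 𝒳

/-- The self-similar group `G` has the subgroup induction property. -/
def HasSubgroupInduction (G : Subgroup (TreeAut X)) : Prop :=
  IsSelfSimilar G ∧ ∀ 𝒳 : Set (Subgroup (TreeAut X)), IsInductive G 𝒳 →
    ∀ H : Subgroup (TreeAut X), H ≤ G → H.FG → H ∈ 𝒳

/-- The self-similar group `G` has the strong subgroup induction property. -/
def HasStrongSubgroupInduction (G : Subgroup (TreeAut X)) : Prop :=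
  IsSelfSimilar G ∧ ∀ 𝒳 : Set (Subgroup (TreeAut X)), IsWeaklyInductive G 𝒳 →
    ∀ H : Subgroup (TreeAut X), H ≤ G → H.FG → H ∈ 𝒳

end TreeAut

/-!
GGS groups. The `p` letters are the residues `0, …, p - 1` modulo `p`; the residue `i` plays the
role of the `(i + 1)`-st child.
-/

namespace GGS

variable {p : ℕ}

/-- The action of the rooted automorphism with permutation `σ` on the first letter. -/
def rootedFun {X : Type*} (σ : Equiv.Perm X) : List X → List X
  | [] => []
  | x :: w => σ x :: w

/-- The rooted automorphism `σ · (1, …, 1)`. -/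
def rooted {X : Type*} (σ : Equiv.Perm X) : TreeAut X where
  toFun := rootedFun σ
  invFun := rootedFun σ⁻¹
  left_inv w := by cases w <;> simp [rootedFun]
  right_inv w := by cases w <;> simp [rootedFun]
  map_rel_iff' {u w} := by
    change rootedFun σ u <+: rootedFun σ w ↔ u <+: w
    cases u <;> cases w <;> simp [rootedFun, List.cons_prefix_cons]

/-- The generator `a = ε · (1, …, 1)`, with `ε` the cyclic permutation `i ↦ i + 1`. -/
def a (p : ℕ) : TreeAut (ZMod p) := rooted (Equiv.addRight 1)

/-- The map on vertices of the automorphism `c = (s 0, …, s (p - 2), c)`. -/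
def directedFun (s : Fin (p - 1) → TreeAut (ZMod p)) : List (ZMod p) → List (ZMod p)
  | [] => []
  | x :: w => if h : x.val < p - 1 then x :: s ⟨x.val, h⟩ w else x :: directedFun s w

theorem directedFun_inv (s : Fin (p - 1) → TreeAut (ZMod p)) (w : List (ZMod p)) :
    directedFun s⁻¹ (directedFun s w) = w := by
  induction w with
  | nil => rfl
  | cons x w ih =>
    by_cases h : x.val < p - 1
    · simp only [directedFun, h, dif_pos, Pi.inv_apply]
      rw [← RelIso.mul_apply, inv_mul_cancel, RelIso.one_apply]
    · simp only [directedFun, h, dif_neg, not_false_eq_true, ih]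

/-- The automorphism `c` determined recursively by `c = (s 0, …, s (p - 2), c)`: it fixes the
first level, its section at the letter `i ≤ p - 2` is `s i`, and its section at the last letter
`p - 1` is `c` itself. -/
def directed (s : Fin (p - 1) → TreeAut (ZMod p)) : TreeAut (ZMod p) where
  toFun := directedFun s
  invFun := directedFun s⁻¹
  left_inv := directedFun_inv s
  right_inv w := by simpa using directedFun_inv s⁻¹ w
  map_rel_iff' {u w} := by
    change directedFun s u <+: directedFun s w ↔ u <+: w
    induction u generalizing w with
    | nil => simp [directedFun]
    | cons x u ih =>
      cases w with
      | nil => by_cases h : x.val < p - 1 <;> simp [directedFun, h]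
      | cons y w =>
        by_cases hxy : x = y
        · subst hxy
          by_cases h : x.val < p - 1
          · simp [directedFun, h, List.cons_prefix_cons, TreeAut.prefix_iff]
          · simp [directedFun, h, List.cons_prefix_cons, ih]
        · by_cases h : x.val < p - 1 <;> by_cases h' : y.val < p - 1 <;>
            simp [directedFun, h, h', List.cons_prefix_cons, hxy]

/-- The generator `b = (a ^ e₀, …, a ^ e_{p-2}, b)`; the exponents may be read as natural
numbers because `a ^ p = 1`. -/
def b (e : Fin (p - 1) → ZMod p) : TreeAut (ZMod p) := directed fun i => a p ^ (e i).val

/-- The group `G_e = ⟨a, b⟩` with defining vector `e`. -/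
def group (e : Fin (p - 1) → ZMod p) : Subgroup (TreeAut (ZMod p)) :=
  Subgroup.closure {a p, b e}

end GGS

/-! Torsion is used through a single consequence: the entries of the defining vector sum to 0
(`sum_extVec_eq_zero`). The abelianisation is seen through two homomorphisms to ℤ/p, the rotation
number `rot` (exponent of a) and `β` (exponent of b).

Every finitely generated H ≤ G is the group of closed walks in a graph whose labels are rotations,
except for finitely many edges labelled b. First-level sections are closed-walk groups of the lifted
graph on V × ℤ/p, where each b-edge has at most one lift labelled b, its other lifts being
rotations. `vertexGroup_mem` inducts on the number of b-edges. If H fixes the first level, then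
either every section sees fewer b-edges in its component, or one component contains the b-lifts of
all of them; in the latter case H lies in a conjugate of ⟨b⟩ and is finite. If H moves the first
level, its sections are conjugate and it suffices to treat one of them. Unless the section or its
own section fixes the first level, the second section maps onto the abelianisation.

For such a full group, `mem_of_isFull` contracts the number of letters b in an element with `rot` =
0 and `β` ≠ 0. The letters of an element are shared out among its sections, so passing to sections
shortens it until it is a conjugate of a power of b by a rotation. Then some section contains all
rotations and a conjugate of b, and `mem_of_rotBy_mem` shortens the conjugator until the group is G
itself. The zero sum keeps p-th powers under control here and provides two non-zero entries of e.

A class need not be closed under conjugation, so all this is run in its conjugation core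
(`IsWeaklyInductive.conj_core`). -/

namespace TreeAut

/-! ### Calculus of sections and conjugation -/

variable {X : Type*}

theorem apply_cons (g : TreeAut X) (x : X) (w : List X) : g (x :: w) = g [x] ++ sec [x] g w :=
  apply_append g [x] w

theorem ext_sec {g h : TreeAut X} (h0 : ∀ x, g [x] = h [x]) (h1 : ∀ x, sec [x] g = sec [x] h) :
    g = h := by
  refine RelIso.ext fun w => ?_
  cases w with
  | nil => rw [List.eq_nil_of_length_eq_zero (g.length_apply []),
      List.eq_nil_of_length_eq_zero (h.length_apply [])]
  | cons x w => rw [apply_cons g x w, apply_cons h x w, h0, h1]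

theorem sec_append (u v : List X) (g : TreeAut X) : sec (u ++ v) g = sec v (sec u g) := by
  refine RelIso.ext fun w => ?_
  have h1 := apply_append g (u ++ v) w
  rw [List.append_assoc, apply_append g u, apply_append g u, apply_append (sec u g) v w,
    List.append_assoc] at h1
  exact (List.append_cancel_left (List.append_cancel_left h1)).symm

theorem sec_nil (g : TreeAut X) : sec [] g = g := by
  refine RelIso.ext fun w => ?_
  have h1 := apply_append g [] w
  rw [List.eq_nil_of_length_eq_zero (g.length_apply [])] at h1
  exact h1.symm

theorem inv_apply_self' (g : TreeAut X) (v : List X) : g⁻¹ (g v) = v := by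
  rw [← RelIso.mul_apply, inv_mul_cancel, RelIso.one_apply]

theorem inv_apply_of_apply_eq {g : TreeAut X} {u v : List X} (h : g u = v) : g⁻¹ v = u := by
  rw [← h, inv_apply_self']

theorem sec_inv (v : List X) (g : TreeAut X) : sec (g v) g⁻¹ = (sec v g)⁻¹ := by
  refine eq_inv_of_mul_eq_one_left ?_
  rw [← sec_mul, inv_mul_cancel, sec_one]

theorem sec_inv_of_apply_eq {g : TreeAut X} {u v : List X} (h : g u = v) :
    sec v g⁻¹ = (sec u g)⁻¹ := by rw [← h, sec_inv]

theorem sec_mem_secSubgroup {H : Subgroup (TreeAut X)} {v : List X} {g : TreeAut X} (hg : g ∈ H)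
    (hv : g v = v) : sec v g ∈ secSubgroup H v := ⟨g, hg, hv, rfl⟩

theorem mem_levelStab_one {g : TreeAut X} : g ∈ levelStab X 1 ↔ ∀ x, g [x] = [x] := by
  refine ⟨fun h x => h [x] rfl, fun h v hv => ?_⟩
  obtain ⟨x, rfl⟩ := List.length_eq_one_iff.1 hv
  exact h x

/-- The conjugate `g H g⁻¹`. -/
abbrev conj (g : TreeAut X) (H : Subgroup (TreeAut X)) : Subgroup (TreeAut X) :=
  H.map (MulAut.conj g).toMonoidHom

theorem mem_conj {g k : TreeAut X} {H : Subgroup (TreeAut X)} :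
    k ∈ conj g H ↔ g⁻¹ * k * g ∈ H := by
  constructor
  · rintro ⟨h, hh, rfl⟩
    simpa [mul_assoc] using hh
  · intro h
    exact ⟨_, h, by simp [mul_assoc]⟩

theorem conj_conj (g h : TreeAut X) (H : Subgroup (TreeAut X)) :
    conj g (conj h H) = conj (g * h) H := by
  ext k
  simp only [mem_conj, mul_inv_rev, mul_assoc]

theorem conj_one (H : Subgroup (TreeAut X)) : conj 1 H = H := by
  ext k
  simp

theorem conj_eq_self {h : TreeAut X} {H : Subgroup (TreeAut X)} (hh : h ∈ H) : conj h H = H := by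
  ext k
  rw [mem_conj, H.mul_mem_cancel_right hh, H.mul_mem_cancel_left (H.inv_mem hh)]

theorem conj_le {g : TreeAut X} {H G : Subgroup (TreeAut X)} (hg : g ∈ G) (hH : H ≤ G) :
    conj g H ≤ G := fun k hk => by
  have := hH (mem_conj.1 hk)
  rwa [G.mul_mem_cancel_right hg, G.mul_mem_cancel_left (G.inv_mem hg)] at this

theorem secSubgroup_conj (g : TreeAut X) (H : Subgroup (TreeAut X)) (v : List X) :
    secSubgroup (conj g H) (g v) = conj (sec v g) (secSubgroup H v) := by
  ext k
  rw [mem_conj]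
  constructor
  · rintro ⟨h, hh, hv, rfl⟩
    have h1 : (g⁻¹ * h * g) v = v := by
      rw [RelIso.mul_apply, RelIso.mul_apply, hv, inv_apply_self']
    refine ⟨_, mem_conj.1 hh, h1, ?_⟩
    rw [sec_mul, sec_mul, hv, sec_inv]
  · rintro ⟨h, hh, hv, hk⟩
    refine ⟨g * h * g⁻¹, mem_conj.2 (by simpa [mul_assoc] using hh), ?_, ?_⟩
    · rw [RelIso.mul_apply, RelIso.mul_apply, inv_apply_self', hv]
    · rw [sec_mul, sec_mul, inv_apply_self', hv, sec_inv, hk]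
      simp [mul_assoc]

theorem secSubgroup_apply {H : Subgroup (TreeAut X)} {h : TreeAut X} (hh : h ∈ H) (v : List X) :
    secSubgroup H (h v) = conj (sec v h) (secSubgroup H v) := by
  rw [← secSubgroup_conj, conj_eq_self hh]

/-- On the first-level stabiliser, taking the section at a letter is a homomorphism, so generators
go to generators. -/
theorem secSubgroup_closure {S : Set (TreeAut X)}
    (hS : Subgroup.closure S ≤ levelStab X 1) (x : X) :
    secSubgroup (Subgroup.closure S) [x] = Subgroup.closure (sec [x] '' S) := by
  have hfix : ∀ g ∈ Subgroup.closure S, g [x] = [x] := fun g hg => mem_levelStab_one.1 (hS hg) x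
  apply le_antisymm
  · rintro _ ⟨g, hg, -, rfl⟩
    induction hg using Subgroup.closure_induction with
    | mem g hg => exact Subgroup.subset_closure ⟨g, hg, rfl⟩
    | one => rw [sec_one]; exact Subgroup.one_mem _
    | mul g h hg hh ihg ihh =>
      rw [sec_mul, hfix h hh]; exact Subgroup.mul_mem _ ihg ihh
    | inv g hg ih => rw [sec_inv_of_apply_eq (hfix g hg)]; exact Subgroup.inv_mem _ ih
  · rw [Subgroup.closure_le]
    rintro _ ⟨g, hg, rfl⟩
    exact ⟨g, Subgroup.subset_closure hg, hfix g (Subgroup.subset_closure hg), rfl⟩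

theorem fg_secSubgroup {H : Subgroup (TreeAut X)} (hH : H.FG) (hs : H ≤ levelStab X 1) (x : X) :
    (secSubgroup H [x]).FG := by
  classical
  obtain ⟨S, rfl⟩ := hH
  rw [secSubgroup_closure hs]
  exact ⟨S.image (sec [x]), by simp⟩

theorem conj_fg {H : Subgroup (TreeAut X)} (hH : H.FG) (g : TreeAut X) : (conj g H).FG := by
  classical
  obtain ⟨S, rfl⟩ := hH
  exact ⟨S.image (MulAut.conj g), by simp [conj, MonoidHom.map_closure]⟩

theorem relIndex_conj (g : TreeAut X) (H L : Subgroup (TreeAut X)) :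
    (conj g H).relIndex (conj g L) = H.relIndex L :=
  Subgroup.relIndex_map_map_of_injective _ _ (MulAut.conj g).injective

/-- Sections at letters of one orbit agree only up to conjugation, so conjugation-closed classes are
needed. Condition (C) survives because the sections of a conjugate by g are the conjugates of the
sections by sections of g, which lie in G. -/
theorem IsWeaklyInductive.conj_core {G : Subgroup (TreeAut X)}
    (hsec : ∀ g ∈ G, ∀ x, sec [x] g ∈ G)
    {𝒳 : Set (Subgroup (TreeAut X))} (h : IsWeaklyInductive G 𝒳) :
    IsWeaklyInductive G {H | ∀ g ∈ G, conj g H ∈ 𝒳} where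
  le H hH := by simpa [conj_one] using h.le _ (hH 1 G.one_mem)
  bot_mem g _ := by simpa using h.bot_mem
  self_mem g hg := by rw [conj_eq_self hg]; exact h.self_mem
  mem_of_finite_index H L hHL hLG hfin hH g hg := by
    refine h.mem_of_finite_index (conj g H) (conj g L) (Subgroup.map_mono hHL) (conj_le hg hLG)
      ⟨?_⟩ (hH g hg)
    rw [relIndex_conj]
    exact hfin.relIndex_ne_zero
  mem_of_sections H hfg hle hsecs g hg := by
    refine h.mem_of_sections _ (conj_fg hfg g) ?_ fun x => ?_
    · refine le_inf (conj_le hg (hle.trans inf_le_left)) fun k hk => ?_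
      refine mem_levelStab_one.2 fun x => ?_
      obtain ⟨k, hk, rfl⟩ := hk
      have hk' := mem_levelStab_one.1 (hle hk).2
      obtain ⟨y, hy⟩ := List.length_eq_one_iff.1 (TreeAut.length_apply (g⁻¹) [x])
      have : g [y] = [x] := by rw [← hy, ← RelIso.mul_apply, mul_inv_cancel, RelIso.one_apply]
      simp only [MulEquiv.coe_toMonoidHom, MulAut.conj_apply]
      rw [RelIso.mul_apply, RelIso.mul_apply, hy, hk' y, this]
    · obtain ⟨y, hy⟩ := List.length_eq_one_iff.1 (TreeAut.length_apply (g⁻¹) [x])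
      have : g [y] = [x] := by rw [← hy, ← RelIso.mul_apply, mul_inv_cancel, RelIso.one_apply]
      rw [← this, secSubgroup_conj]
      exact hsecs y _ (hsec g hg y)

end TreeAut

/-! Groupoids presented by graphs with edges labelled by group elements. -/

/-- `Walk E v g u`: the element `g` is the product of the labels (read from right to left) along a
walk from `v` to `u` in the labelled graph `E`, edges being allowed in both directions. -/
inductive Walk {V Γ : Type*} [Group Γ] (E : V → Γ → V → Prop) (v : V) : Γ → V → Prop
  | refl : Walk E v 1 v
  | fwd {g h : Γ} {u w : V} : Walk E v g u → E u h w → Walk E v (h * g) w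
  | bwd {g h : Γ} {u w : V} : Walk E v g u → E w h u → Walk E v (h⁻¹ * g) w

namespace Walk

variable {V Γ : Type*} [Group Γ] {E : V → Γ → V → Prop} {u v w : V} {g h : Γ}

theorem trans (h1 : Walk E v g u) (h2 : Walk E u h w) : Walk E v (h * g) w := by
  induction h2 with
  | refl => simpa using h1
  | fwd _ he ih => rw [mul_assoc]; exact ih.fwd he
  | bwd _ he ih => rw [mul_assoc]; exact ih.bwd he

theorem single (he : E u h w) : Walk E u h w := by simpa using Walk.refl.fwd he

theorem single_inv (he : E u h w) : Walk E w h⁻¹ u := by simpa using Walk.refl.bwd he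

theorem symm (h1 : Walk E v g u) : Walk E u g⁻¹ v := by
  induction h1 with
  | refl => simpa using Walk.refl
  | fwd _ he ih => rw [mul_inv_rev]; exact (single_inv he).trans ih
  | bwd _ he ih => rw [mul_inv_rev, inv_inv]; exact (single he).trans ih

theorem mono {E' : V → Γ → V → Prop} (hE : ∀ u g w, E u g w → E' u g w) (h1 : Walk E v g u) :
    Walk E' v g u := by
  induction h1 with
  | refl => exact .refl
  | fwd _ he ih => exact ih.fwd (hE _ _ _ he)
  | bwd _ he ih => exact ih.bwd (hE _ _ _ he)

end Walk

/-- The group of labels of closed walks at `v`. -/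
def vertexGroup {V Γ : Type*} [Group Γ] (E : V → Γ → V → Prop) (v : V) : Subgroup Γ where
  carrier := {g | Walk E v g v}
  one_mem' := .refl
  mul_mem' hg hh := Walk.trans hh hg
  inv_mem' hg := Walk.symm hg

theorem mem_vertexGroup {V Γ : Type*} [Group Γ] {E : V → Γ → V → Prop} {v : V} {g : Γ} :
    g ∈ vertexGroup E v ↔ Walk E v g v := Iff.rfl

/-- The subgraph of `E` formed by the connected component of `v`. -/
def componentGraph {V Γ : Type*} [Group Γ] (E : V → Γ → V → Prop) (v : V) : V → Γ → V → Prop :=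
  fun u g w => E u g w ∧ ∃ k, Walk E v k u

/-- A walk never leaves its component; discarding the other components is what lets the number of
b-edges drop. -/
theorem vertexGroup_componentGraph {V Γ : Type*} [Group Γ] (E : V → Γ → V → Prop) (v : V) :
    vertexGroup (componentGraph E v) v = vertexGroup E v := by
  have key : ∀ {g u}, Walk E v g u → Walk (componentGraph E v) v g u := by
    intro g u h
    induction h with
    | refl => exact .refl
    | fwd h1 he ih => exact ih.fwd ⟨he, _, h1⟩
    | bwd h1 he ih => exact ih.bwd ⟨he, _, h1.bwd he⟩
  ext g
  exact ⟨fun h => Walk.mono (fun _ _ _ h => h.1) h, fun h => key h⟩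

/-! ### Graphs for first-level sections -/

namespace TreeAut

variable {X V : Type*}

/-- The graph of first-level sections of a graph labelled by tree automorphisms. -/
def sectionGraph (E : V → TreeAut X → V → Prop) : V × X → TreeAut X → V × X → Prop :=
  fun s k t => ∃ g, E s.1 g t.1 ∧ g [s.2] = [t.2] ∧ sec [s.2] g = k

/-- Unique lifting of walks: a walk with label g lifts from (v, x), its second coordinate follows
the action of g on x, and its labels multiply to the section of g at x. -/
theorem walk_sectionGraph {E : V → TreeAut X → V → Prop} {v : V} {x : X} {k : TreeAut X}
    {t : V × X} : Walk (sectionGraph E) (v, x) k t ↔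
      ∃ g, Walk E v g t.1 ∧ g [x] = [t.2] ∧ sec [x] g = k := by
  constructor
  · intro h
    induction h with
    | refl => exact ⟨1, .refl, rfl, sec_one _⟩
    | fwd _ he ih =>
      obtain ⟨g, h1, h2, rfl⟩ := ih
      obtain ⟨l, h3, h4, rfl⟩ := he
      exact ⟨l * g, h1.fwd h3, by rw [RelIso.mul_apply, h2, h4], by rw [sec_mul, h2]⟩
    | bwd _ he ih =>
      obtain ⟨g, h1, h2, rfl⟩ := ih
      obtain ⟨l, h3, h4, rfl⟩ := he
      exact ⟨l⁻¹ * g, h1.bwd h3, by rw [RelIso.mul_apply, h2, inv_apply_of_apply_eq h4],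
        by rw [sec_mul, h2, sec_inv_of_apply_eq h4]⟩
  · rintro ⟨g, h1, h2, rfl⟩
    obtain ⟨u, y⟩ := t
    dsimp only at h1 h2
    induction h1 generalizing y with
    | refl =>
      obtain rfl : x = y := by simpa using h2
      rw [sec_one]; exact .refl
    | @fwd g l u w _ he ih =>
      obtain ⟨z, hz⟩ := List.length_eq_one_iff.1 (g.length_apply [x])
      rw [sec_mul, hz]
      rw [RelIso.mul_apply, hz] at h2
      exact (ih z hz).fwd ⟨l, he, h2, rfl⟩
    | @bwd g l u w _ he ih =>
      obtain ⟨z, hz⟩ := List.length_eq_one_iff.1 (g.length_apply [x])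
      rw [RelIso.mul_apply, hz] at h2
      have h3 : l [y] = [z] := by rw [← h2, ← RelIso.mul_apply, mul_inv_cancel, RelIso.one_apply]
      rw [sec_mul, hz, sec_inv_of_apply_eq h3]
      exact (ih z hz).bwd ⟨l, he, h3, rfl⟩

theorem vertexGroup_sectionGraph (E : V → TreeAut X → V → Prop) (v : V) (x : X) :
    vertexGroup (sectionGraph E) (v, x) = secSubgroup (vertexGroup E v) [x] := by
  ext k
  rw [mem_vertexGroup, walk_sectionGraph]
  rfl

end TreeAut

/-! ### Generators of GGS groups and the rotation number -/

namespace GGS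

open TreeAut

variable {p : ℕ}

/-- The rooted automorphism that translates the first letter by `z`. -/
def rotBy (z : ZMod p) : TreeAut (ZMod p) := rooted (Equiv.addRight z)

theorem rotBy_singleton (z x : ZMod p) : rotBy z [x] = [x + z] := rfl

theorem sec_rotBy (z x : ZMod p) : sec [x] (rotBy z) = 1 := by
  refine RelIso.ext fun w => ?_
  have h := apply_append (rotBy z) [x] w
  exact (List.append_cancel_left (as := [x + z]) h).symm

theorem rotBy_zero : rotBy (0 : ZMod p) = 1 :=
  ext_sec (fun x => by rw [rotBy_singleton, add_zero]; rfl) fun x => by rw [sec_rotBy, sec_one]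

theorem rotBy_add (y z : ZMod p) : rotBy (y + z) = rotBy y * rotBy z :=
  ext_sec (fun x => by
    rw [RelIso.mul_apply, rotBy_singleton, rotBy_singleton, rotBy_singleton, add_assoc,
      add_comm y]) fun x => by rw [sec_mul, rotBy_singleton, sec_rotBy, sec_rotBy, sec_rotBy, one_mul]

theorem rotBy_neg (z : ZMod p) : rotBy (-z) = (rotBy z)⁻¹ :=
  eq_inv_of_mul_eq_one_left (by rw [← rotBy_add, neg_add_cancel, rotBy_zero])

theorem a_eq_rotBy : a p = rotBy 1 := rfl

theorem rotBy_pow (z : ZMod p) (n : ℕ) : rotBy z ^ n = rotBy ((n : ZMod p) * z) := by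
  induction n with
  | zero => simp [rotBy_zero]
  | succ n ih => rw [pow_succ, ih, ← rotBy_add]; push_cast; ring_nf

theorem a_pow_val [NeZero p] (z : ZMod p) : a p ^ z.val = rotBy z := by
  rw [a_eq_rotBy, rotBy_pow, ZMod.natCast_zmod_val, mul_one]

/-- The defining vector, extended by `0` to the last letter `p - 1`. -/
def extVec (e : Fin (p - 1) → ZMod p) (x : ZMod p) : ZMod p :=
  if h : x.val < p - 1 then e ⟨x.val, h⟩ else 0

theorem val_lt_iff [NeZero p] {x : ZMod p} : x.val < p - 1 ↔ x ≠ -1 := by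
  obtain ⟨n, rfl⟩ := Nat.exists_eq_succ_of_ne_zero (NeZero.ne p)
  have h1 := ZMod.val_neg_one n
  have h2 := ZMod.val_lt x
  constructor
  · rintro h rfl
    rw [h1] at h
    simp at h
  · intro h
    have : x.val ≠ n := fun h3 => h (ZMod.val_injective _ (h3.trans h1.symm))
    simp only [Nat.succ_eq_add_one] at h2 ⊢
    omega

theorem extVec_neg_one [NeZero p] (e : Fin (p - 1) → ZMod p) : extVec e (-1) = 0 := by
  rw [extVec, dif_neg]
  simp [val_lt_iff]

theorem exists_extVec_ne_zero [NeZero p] {e : Fin (p - 1) → ZMod p} (he : e ≠ 0) :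
    ∃ x, extVec e x ≠ 0 := by
  obtain ⟨i, hi⟩ := Function.ne_iff.1 he
  have h1 : i.1 < p := by have := i.2; omega
  refine ⟨(i.1 : ZMod p), ?_⟩
  have h2 : (i.1 : ZMod p).val = i.1 := ZMod.val_cast_of_lt h1
  rw [extVec, dif_pos (by rw [h2]; exact i.2)]
  simpa only [h2, Pi.zero_apply] using hi

theorem b_singleton (e : Fin (p - 1) → ZMod p) (x : ZMod p) : b e [x] = [x] := by
  change directedFun _ [x] = [x]
  by_cases h : x.val < p - 1
  · simp only [directedFun, h, dif_pos]
    rw [List.eq_nil_of_length_eq_zero (TreeAut.length_apply _ [])]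
  · simp [directedFun, h]

theorem sec_b_of_ne [NeZero p] (e : Fin (p - 1) → ZMod p) {x : ZMod p} (hx : x ≠ -1) :
    sec [x] (b e) = rotBy (extVec e x) := by
  refine RelIso.ext fun w => ?_
  have h := apply_append (b e) [x] w
  rw [b_singleton] at h
  have h2 : b e ([x] ++ w) = [x] ++ (a p ^ (e ⟨x.val, val_lt_iff.2 hx⟩).val) w := by
    change directedFun _ (x :: w) = _
    simp [directedFun, val_lt_iff.2 hx]
  rw [h2] at h
  rw [← List.append_cancel_left h, a_pow_val, extVec, dif_pos]

theorem sec_b_neg_one [NeZero p] (e : Fin (p - 1) → ZMod p) : sec [-1] (b e) = b e := by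
  refine RelIso.ext fun w => ?_
  have h := apply_append (b e) [-1] w
  rw [b_singleton] at h
  have h2 : b e ([-1] ++ w) = [-1] ++ b e w := by
    change directedFun _ (-1 :: w) = _
    have : ¬ (-1 : ZMod p).val < p - 1 := by simp [val_lt_iff]
    simp only [directedFun, this, dif_neg, not_false_eq_true]
    rfl
  rw [h2] at h
  exact (List.append_cancel_left h).symm

theorem a_mem (e : Fin (p - 1) → ZMod p) : a p ∈ group e :=
  Subgroup.subset_closure (by simp)

theorem b_mem (e : Fin (p - 1) → ZMod p) : b e ∈ group e :=
  Subgroup.subset_closure (by simp)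

theorem rotBy_mem [NeZero p] (e : Fin (p - 1) → ZMod p) (z : ZMod p) : rotBy z ∈ group e := by
  rw [← a_pow_val]; exact Subgroup.pow_mem _ (a_mem e) _

/-- Induction principle for the elements of a GGS group. -/
theorem group_induction [NeZero p] {e : Fin (p - 1) → ZMod p} {P : TreeAut (ZMod p) → Prop}
    (one : P 1) (rot : ∀ z g, g ∈ group e → P g → P (rotBy z * g))
    (dir : ∀ g, g ∈ group e → P g → P (b e * g))
    (dir_inv : ∀ g, g ∈ group e → P g → P ((b e)⁻¹ * g)) {g : TreeAut (ZMod p)}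
    (hg : g ∈ group e) : P g := by
  induction hg using Subgroup.closure_induction_left with
  | one => exact one
  | mul_left x hx y hy ih =>
    obtain rfl | rfl := hx
    · exact rot 1 y hy ih
    · exact dir y hy ih
  | inv_mul_cancel x hx y hy ih =>
    obtain rfl | rfl := hx
    · rw [a_eq_rotBy, ← rotBy_neg]
      exact rot _ y hy ih
    · exact dir_inv y hy ih

/-- The translation of the first letter induced by an element of the group. -/
def rot (g : TreeAut (ZMod p)) : ZMod p := (g [0]).headD 0

theorem rot_one : rot (1 : TreeAut (ZMod p)) = 0 := rfl

theorem rot_rotBy (z : ZMod p) : rot (rotBy z) = z := zero_add z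

theorem rot_b (e : Fin (p - 1) → ZMod p) : rot (b e) = 0 := by
  rw [rot, b_singleton]; rfl

theorem sec_b_inv (e : Fin (p - 1) → ZMod p) (x : ZMod p) :
    sec [x] (b e)⁻¹ = (sec [x] (b e))⁻¹ := sec_inv_of_apply_eq (b_singleton e x)

theorem sec_b_pow (e : Fin (p - 1) → ZMod p) (n : ℕ) (x : ZMod p) :
    sec [x] (b e ^ n) = sec [x] (b e) ^ n := by
  induction n with
  | zero => simp [sec_one]
  | succ n ih => rw [pow_succ, sec_mul, b_singleton, ih, pow_succ]

variable [NeZero p] {e : Fin (p - 1) → ZMod p} {g h : TreeAut (ZMod p)}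

theorem apply_singleton (hg : g ∈ group e) (x : ZMod p) : g [x] = [x + rot g] := by
  have : ∃ z, ∀ x, g [x] = [x + z] := by
    refine group_induction (P := fun g => ∃ z, ∀ x, g [x] = [x + z]) ⟨0, fun x => by simp⟩ ?_ ?_ ?_ hg
    · rintro y g - ⟨z, hz⟩
      exact ⟨z + y, fun x => by rw [RelIso.mul_apply, hz, rotBy_singleton, add_assoc]⟩
    · rintro g - ⟨z, hz⟩
      exact ⟨z, fun x => by rw [RelIso.mul_apply, hz, b_singleton]⟩
    · rintro g - ⟨z, hz⟩
      exact ⟨z, fun x => by rw [RelIso.mul_apply, hz, inv_apply_of_apply_eq (b_singleton e _)]⟩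
  obtain ⟨z, hz⟩ := this
  have : rot g = z := by rw [rot, hz]; simp
  rw [hz, this]

theorem rot_mul (hg : g ∈ group e) (hh : h ∈ group e) : rot (g * h) = rot g + rot h := by
  have h1 := apply_singleton ((group e).mul_mem hg hh) 0
  rw [RelIso.mul_apply, apply_singleton hh, apply_singleton hg] at h1
  simp only [zero_add, List.cons.injEq, and_true] at h1
  rw [← h1, add_comm]

theorem rot_inv (hg : g ∈ group e) : rot g⁻¹ = -rot g := by
  have h1 := rot_mul hg ((group e).inv_mem hg)
  rw [mul_inv_cancel, rot_one] at h1
  linear_combination -h1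

theorem rot_pow (hg : g ∈ group e) (n : ℕ) : rot (g ^ n) = (n : ZMod p) * rot g := by
  induction n with
  | zero => simp [rot_one]
  | succ n ih => rw [pow_succ, rot_mul ((group e).pow_mem hg n) hg, ih]; push_cast; ring

theorem rot_eq_zero_iff (hg : g ∈ group e) : rot g = 0 ↔ g ∈ levelStab (ZMod p) 1 := by
  rw [mem_levelStab_one]
  constructor
  · intro h x; rw [apply_singleton hg, h, add_zero]
  · intro h
    have := h 0
    rw [apply_singleton hg] at this
    simpa using this

theorem rot_eq_zero_of_apply_eq (hg : g ∈ group e) {x : ZMod p} (h : g [x] = [x]) : rot g = 0 := by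
  rw [apply_singleton hg] at h
  simpa using h

theorem sec_mem (hg : g ∈ group e) (x : ZMod p) : sec [x] g ∈ group e := by
  have hb : ∀ x, sec [x] (b e) ∈ group e := fun x => by
    by_cases hx : x = -1
    · rw [hx, sec_b_neg_one]; exact b_mem e
    · rw [sec_b_of_ne e hx]; exact rotBy_mem e _
  refine group_induction (P := fun g => sec [x] g ∈ group e) ?_ ?_ ?_ ?_ hg
  · rw [sec_one]; exact Subgroup.one_mem _
  · intro z g hg ih
    rw [sec_mul, apply_singleton hg, sec_rotBy, one_mul]; exact ih
  · intro g hg ih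
    rw [sec_mul, apply_singleton hg]; exact Subgroup.mul_mem _ (hb _) ih
  · intro g hg ih
    rw [sec_mul, apply_singleton hg, sec_inv_of_apply_eq (b_singleton e _)]
    exact Subgroup.mul_mem _ (Subgroup.inv_mem _ (hb _)) ih

theorem isSelfSimilar_group (e : Fin (p - 1) → ZMod p) : IsSelfSimilar (group e) := by
  have key : ∀ v : List (ZMod p), ∀ g ∈ group e, sec v g ∈ group e := by
    intro v
    induction v with
    | nil => intro g hg; rwa [sec_nil]
    | cons x v ih =>
      intro g hg
      rw [show x :: v = [x] ++ v from rfl, sec_append]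
      exact ih _ (sec_mem hg x)
  rintro v _ ⟨g, hg, -, rfl⟩
  exact key v g hg

theorem sec_mul_of_mem (g : TreeAut (ZMod p)) (hh : h ∈ group e) (x : ZMod p) :
    sec [x] (g * h) = sec [x + rot h] g * sec [x] h := by
  rw [sec_mul, apply_singleton hh]

theorem sec_rotBy_mul (z x : ZMod p) (hg : g ∈ group e) : sec [x] (rotBy z * g) = sec [x] g := by
  rw [sec_mul_of_mem _ hg, sec_rotBy, one_mul]

theorem b_pow_singleton (e : Fin (p - 1) → ZMod p) (n : ℕ) (x : ZMod p) :
    (b e ^ n) [x] = [x] := by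
  rw [apply_singleton ((group e).pow_mem (b_mem e) n), rot_pow (b_mem e), rot_b, mul_zero, add_zero]

/-- By induction on words: the sections of the p-th power are p-th powers of rotations, which are
trivial, and the p-th power of b again at the letter -1. -/
theorem b_pow_eq_one (e : Fin (p - 1) → ZMod p) : b e ^ p = 1 := by
  have key : ∀ w : List (ZMod p), (b e ^ p) w = w := by
    intro w
    induction w with
    | nil => exact List.eq_nil_of_length_eq_zero (TreeAut.length_apply _ [])
    | cons x w ih =>
      rw [apply_cons, b_pow_singleton, sec_b_pow]
      by_cases hx : x = -1
      · rw [hx, sec_b_neg_one, ih]; rfl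
      · rw [sec_b_of_ne e hx, rotBy_pow, CharP.cast_eq_zero, zero_mul, rotBy_zero]; rfl
  exact RelIso.ext key

end GGS

/-! ### The exponent of b as a homomorphism -/

namespace GGS

open TreeAut

/-- Every non-zero function on `ℤ/p` is sent to the constant function `1` by some linear operator
that commutes with translations: a multiple of a power of the difference operator. -/
theorem exists_shift_invariant_operator {p : ℕ} [Fact p.Prime] {f : ZMod p → ZMod p} (hf : f ≠ 0) :
    ∃ D : (ZMod p → ZMod p) →ₗ[ZMod p] (ZMod p → ZMod p),
      (∀ (g : ZMod p → ZMod p) (z x : ZMod p), D (fun y => g (y + z)) x = D g (x + z)) ∧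
        ∀ x, D f x = 1 := by
  let S : Module.End (ZMod p) (ZMod p → ZMod p) := LinearMap.funLeft (ZMod p) (ZMod p) (· + 1)
  have hS : ∀ (n : ℕ) (g : ZMod p → ZMod p) (x : ZMod p), (S ^ n) g x = g (x + n) := by
    intro n
    induction n with
    | zero => intro g x; simp
    | succ n ih =>
      intro g x
      rw [pow_succ, Module.End.mul_apply, ih]
      change g (x + n + 1) = _
      push_cast; ring_nf
  have : CharP (Module.End (ZMod p) (ZMod p → ZMod p)) p :=
    charP_of_injective_algebraMap
      (algebraMap (ZMod p) (Module.End (ZMod p) (ZMod p → ZMod p))).injective p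
  -- In characteristic p this power equals S ^ p - 1, and translating p times by 1 is the identity.
  have hnil : (S - 1) ^ p = 0 := by
    rw [sub_pow_char_of_commute p (Commute.one_right S), one_pow, sub_eq_zero]
    refine LinearMap.ext fun g => funext fun x => ?_
    rw [hS]; simp
  have hshift : ∀ (n : ℕ) (g : ZMod p → ZMod p) (z x : ZMod p),
      ((S - 1) ^ n) (fun y => g (y + z)) x = ((S - 1) ^ n) g (x + z) := by
    intro n
    induction n with
    | zero => intro g z x; rfl
    | succ n ih =>
      intro g z x
      rw [pow_succ, Module.End.mul_apply, Module.End.mul_apply, ← ih]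
      refine congrFun (congrArg ((S - 1) ^ n : Module.End (ZMod p) (ZMod p → ZMod p))
        (funext fun y => ?_)) x
      change g (y + 1 + z) - g (y + z) = g (y + z + 1) - g (y + z)
      ring_nf
  classical
  -- The last non-zero iterated difference of f is killed by S - 1, hence constant; rescaling makes
  -- it 1.
  have hex : ∃ n : ℕ, ((S - 1) ^ n) f = 0 := ⟨p, by rw [hnil]; rfl⟩
  obtain ⟨m, hm⟩ : ∃ m, Nat.find hex = m + 1 := by
    refine Nat.exists_eq_succ_of_ne_zero fun h0 => hf ?_
    have := Nat.find_spec hex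
    rw [h0] at this
    simpa using this
  have h1 : ((S - 1) ^ (m + 1)) f = 0 := hm ▸ Nat.find_spec hex
  have h2 : ((S - 1) ^ m) f ≠ 0 := Nat.find_min hex (by omega)
  set k := ((S - 1) ^ m) f with hk
  have h3 : ∀ x, k (x + 1) = k x := by
    intro x
    rw [pow_succ', Module.End.mul_apply, ← hk] at h1
    exact sub_eq_zero.1 (congrFun h1 x)
  have h4 : ∀ n : ℕ, k n = k 0 := by
    intro n
    induction n with
    | zero => simp
    | succ n ih => rw [Nat.cast_succ, h3, ih]
  have h5 : ∀ x, k x = k 0 := fun x => by rw [← ZMod.natCast_zmod_val x, h4]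
  have h6 : k 0 ≠ 0 := fun h => h2 (funext fun x => (h5 x).trans h)
  refine ⟨(k 0)⁻¹ • (S - 1) ^ m, fun g z x => ?_, fun x => ?_⟩
  · simp only [LinearMap.smul_apply, Pi.smul_apply]
    rw [hshift]
  · simp only [LinearMap.smul_apply, Pi.smul_apply]
    rw [← hk, h5 x, smul_eq_mul, inv_mul_cancel₀ h6]

/-- `β` is the homomorphism from the GGS group to `ℤ/p` that sends `a` to `0` and `b` to `1`; moreover,
elements outside its kernel have a first-level section that moves the first level. -/
structure IsBExponent {p : ℕ} (e : Fin (p - 1) → ZMod p) (β : TreeAut (ZMod p) → ZMod p) :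
    Prop where
  map_mul : ∀ {g h}, g ∈ group e → h ∈ group e → β (g * h) = β g + β h
  map_rotBy : ∀ z, β (rotBy z) = 0
  map_b : β (b e) = 1
  exists_rot_sec_ne_zero : ∀ {g}, g ∈ group e → β g ≠ 0 → ∃ x, rot (sec [x] g) ≠ 0

variable {p : ℕ} {e : Fin (p - 1) → ZMod p} {g h : TreeAut (ZMod p)}

theorem rot_sec_b [NeZero p] (e : Fin (p - 1) → ZMod p) (x : ZMod p) :
    rot (sec [x] (b e)) = extVec e x := by
  by_cases hx : x = -1
  · rw [hx, sec_b_neg_one, rot_b, extVec_neg_one]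
  · rw [sec_b_of_ne e hx, rot_rotBy]

theorem rot_sec_mul [NeZero p] (hg : g ∈ group e) (hh : h ∈ group e) (x : ZMod p) :
    rot (sec [x] (g * h)) = rot (sec [x + rot h] g) + rot (sec [x] h) := by
  rw [sec_mul_of_mem _ hh, rot_mul (sec_mem hg _) (sec_mem hh _)]

/-- The rotation numbers of the sections form a cocycle: the vector of g * h is a translate of the
vector of g plus the vector of h. An operator D that commutes with translations and sends the vector
of b to 1 makes every vector constant, which removes the translation and leaves a homomorphism. It
depends only on section rotations, which gives the last field. -/
theorem exists_isBExponent [Fact p.Prime] (he : e ≠ 0) : ∃ β, IsBExponent e β := by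
  obtain ⟨x₀, hx₀⟩ := exists_extVec_ne_zero he
  obtain ⟨D, hD, hD1⟩ := exists_shift_invariant_operator (f := extVec e)
    (fun h => hx₀ (congrFun h x₀))
  let vec : TreeAut (ZMod p) → ZMod p → ZMod p := fun g x => rot (sec [x] g)
  have hmul : ∀ {g h}, g ∈ group e → h ∈ group e → ∀ x,
      D (vec (g * h)) x = D (vec g) (x + rot h) + D (vec h) x := by
    intro g h hg hh x
    have : vec (g * h) = (fun y => vec g (y + rot h)) + vec h :=
      funext fun y => rot_sec_mul hg hh y
    rw [this, map_add, Pi.add_apply, hD]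
  have hb : ∀ x, D (vec (b e)) x = 1 := fun x => by
    rw [← hD1 x, show vec (b e) = extVec e from funext (rot_sec_b e)]
  have hbi : ∀ x, D (vec (b e)⁻¹) x = -1 := fun x => by
    have h1 := hmul (b_mem e) ((group e).inv_mem (b_mem e)) x
    rw [hb, mul_inv_cancel, show vec 1 = 0 from funext fun x => by simp [vec, sec_one, rot_one],
      map_zero, Pi.zero_apply] at h1
    linear_combination -h1
  have hr : ∀ z x, D (vec (rotBy z)) x = 0 := fun z x => by
    rw [show vec (rotBy z) = 0 from funext fun x => by simp [vec, sec_rotBy, rot_one], map_zero,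
      Pi.zero_apply]
  have hconst : ∀ {g}, g ∈ group e → ∃ k, ∀ x, D (vec g) x = k := by
    intro g hg
    refine group_induction (P := fun g => ∃ k, ∀ x, D (vec g) x = k) ?_ ?_ ?_ ?_ hg
    · exact ⟨0, fun x => by rw [← rotBy_zero, hr]⟩
    · rintro z g hg ⟨k, hk⟩
      exact ⟨k, fun x => by rw [hmul (rotBy_mem e z) hg, hr, hk, zero_add]⟩
    · rintro g hg ⟨k, hk⟩
      exact ⟨1 + k, fun x => by rw [hmul (b_mem e) hg, hb, hk]⟩
    · rintro g hg ⟨k, hk⟩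
      exact ⟨-1 + k, fun x => by rw [hmul ((group e).inv_mem (b_mem e)) hg, hbi, hk]⟩
  refine ⟨fun g => D (vec g) 0, ⟨fun {g h} hg hh => ?_, fun z => hr z 0, hb 0, fun {g} hg h0 => ?_⟩⟩
  · obtain ⟨k, hk⟩ := hconst hg
    rw [hmul hg hh, hk, hk]
  · by_contra hcon
    push Not at hcon
    refine h0 ?_
    rw [show vec g = 0 from funext hcon, map_zero, Pi.zero_apply]

namespace IsBExponent

variable [Fact p.Prime] {β : TreeAut (ZMod p) → ZMod p}

theorem map_one (hβ : IsBExponent e β) : β 1 = 0 := by rw [← rotBy_zero, hβ.map_rotBy]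

theorem map_inv (hβ : IsBExponent e β) (hg : g ∈ group e) : β g⁻¹ = -β g := by
  have h1 := hβ.map_mul hg ((group e).inv_mem hg)
  rw [mul_inv_cancel, hβ.map_one] at h1
  linear_combination -h1

theorem map_conj (hβ : IsBExponent e β) (hg : g ∈ group e) (hh : h ∈ group e) :
    β (h * g * h⁻¹) = β g := by
  rw [hβ.map_mul ((group e).mul_mem hh hg) ((group e).inv_mem hh), hβ.map_mul hh hg, hβ.map_inv hh]
  ring

theorem map_sec_mul (hβ : IsBExponent e β) (hg : g ∈ group e) (hh : h ∈ group e) (x : ZMod p) :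
    β (sec [x] (g * h)) = β (sec [x + rot h] g) + β (sec [x] h) := by
  rw [sec_mul_of_mem _ hh, hβ.map_mul (sec_mem hg _) (sec_mem hh _)]

theorem map_sec_b (hβ : IsBExponent e β) (x : ZMod p) :
    β (sec [x] (b e)) = if x = -1 then 1 else 0 := by
  split_ifs with hx
  · rw [hx, sec_b_neg_one, hβ.map_b]
  · rw [sec_b_of_ne e hx, hβ.map_rotBy]

theorem map_sec_b_inv (hβ : IsBExponent e β) (x : ZMod p) :
    β (sec [x] (b e)⁻¹) = -if x = -1 then 1 else 0 := by
  rw [sec_b_inv, hβ.map_inv (sec_mem (b_mem e) x), hβ.map_sec_b]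

/-- Each letter b of a word passes to exactly one section as b and to the others as a rotation. -/
theorem sum_sec (hβ : IsBExponent e β) (hg : g ∈ group e) : ∑ x, β (sec [x] g) = β g := by
  refine group_induction (P := fun g => ∑ x, β (sec [x] g) = β g) ?_ ?_ ?_ ?_ hg
  · simp [sec_one, hβ.map_one]
  · intro z g hg ih
    simp_rw [sec_rotBy_mul _ _ hg]
    rw [ih, hβ.map_mul (rotBy_mem e z) hg, hβ.map_rotBy, zero_add]
  · intro g hg ih
    simp_rw [hβ.map_sec_mul (b_mem e) hg, Finset.sum_add_distrib]
    rw [ih, hβ.map_mul (b_mem e) hg, show ∑ x, β (sec [x + rot g] (b e)) = ∑ x, β (sec [x] (b e)) from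
      Equiv.sum_comp (Equiv.addRight (rot g)) (fun x => β (sec [x] (b e)))]
    simp [hβ.map_sec_b, hβ.map_b]
  · intro g hg ih
    have hbi := (group e).inv_mem (b_mem e)
    simp_rw [hβ.map_sec_mul hbi hg, Finset.sum_add_distrib]
    rw [ih, hβ.map_mul hbi hg, show ∑ x, β (sec [x + rot g] (b e)⁻¹) = ∑ x, β (sec [x] (b e)⁻¹) from
      Equiv.sum_comp (Equiv.addRight (rot g)) (fun x => β (sec [x] (b e)⁻¹)), hβ.map_inv (b_mem e)]
    simp [hβ.map_sec_b_inv, hβ.map_b]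

/-- A letter b met after translation by c contributes b to the section at y = -1 - c, and rotates
the section at x by the entry at x + c = x - y - 1. So the exponents of b in the sections determine
their rotations by convolution with e. -/
theorem rot_sec_eq_sum (hβ : IsBExponent e β) (hg : g ∈ group e) (x : ZMod p) :
    rot (sec [x] g) = ∑ y, β (sec [y] g) * extVec e (x - y - 1) := by
  have hb : ∀ c x : ZMod p, extVec e (x + c) =
      ∑ y, (if y + c = -1 then 1 else 0) * extVec e (x - y - 1) := by
    intro c x
    simp_rw [ite_mul, one_mul, zero_mul, ← eq_sub_iff_add_eq]
    rw [Finset.sum_ite_eq' Finset.univ, if_pos (Finset.mem_univ _)]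
    ring_nf
  refine group_induction (P := fun g => ∀ x, rot (sec [x] g) =
    ∑ y, β (sec [y] g) * extVec e (x - y - 1)) ?_ ?_ ?_ ?_ hg x
  · simp [sec_one, hβ.map_one, rot_one]
  · intro z g hg ih x
    simp_rw [sec_rotBy_mul _ _ hg]
    rw [ih]
  · intro g hg ih x
    simp_rw [hβ.map_sec_mul (b_mem e) hg, add_mul, Finset.sum_add_distrib]
    rw [rot_sec_mul (b_mem e) hg, ih]
    simp_rw [rot_sec_b, hβ.map_sec_b]
    rw [hb]
  · intro g hg ih x
    have hbi := (group e).inv_mem (b_mem e)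
    simp_rw [hβ.map_sec_mul hbi hg, add_mul, Finset.sum_add_distrib]
    rw [rot_sec_mul hbi hg, ih]
    simp_rw [sec_b_inv, rot_inv (sec_mem (b_mem e) _), hβ.map_inv (sec_mem (b_mem e) _), rot_sec_b,
      hβ.map_sec_b, neg_mul, Finset.sum_neg_distrib]
    rw [hb]

theorem sum_rot_sec (hβ : IsBExponent e β) (hg : g ∈ group e) :
    ∑ x, rot (sec [x] g) = β g * ∑ x, extVec e x := by
  simp_rw [hβ.rot_sec_eq_sum hg]
  rw [Finset.sum_comm, ← hβ.sum_sec hg, Finset.sum_mul]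
  refine Finset.sum_congr rfl fun y _ => ?_
  rw [← Finset.mul_sum]
  congr 1
  simp_rw [sub_sub]
  exact Equiv.sum_comp (Equiv.subRight (y + 1)) (extVec e)

end IsBExponent

/-! ### Sections of p-th powers and the zero-sum condition -/

theorem sum_range_orbit [Fact p.Prime] {M : Type*} [AddCommMonoid M] {c : ZMod p} (hc : c ≠ 0)
    (x : ZMod p) (F : ZMod p → M) : ∑ i ∈ Finset.range p, F (x + i * c) = ∑ y, F y := by
  refine Finset.sum_nbij' (fun i => x + i * c) (fun y => ((y - x) * c⁻¹).val) ?_ ?_ ?_ ?_ ?_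
  · simp
  · intro y _; simpa using ZMod.val_lt _
  · intro i hi
    have : x + i * c - x = i * c := by ring
    rw [this, mul_assoc, mul_inv_cancel₀ hc, mul_one, ZMod.val_cast_of_lt (Finset.mem_range.1 hi)]
  · intro y _
    rw [ZMod.natCast_zmod_val, mul_assoc, inv_mul_cancel₀ hc]; ring
  · simp

theorem sec_pow_succ [NeZero p] (hg : g ∈ group e) (x : ZMod p) (n : ℕ) :
    sec [x] (g ^ (n + 1)) = sec [x + n * rot g] g * sec [x] (g ^ n) := by
  rw [pow_succ', sec_mul_of_mem _ ((group e).pow_mem hg n), rot_pow hg]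

theorem rot_pow_prime [NeZero p] (hg : g ∈ group e) : rot (g ^ p) = 0 := by
  rw [rot_pow hg, CharP.cast_eq_zero, zero_mul]

/-- When g moves the first level, a section of its p-th power is the product of all sections of g
along the full orbit. -/
theorem rot_sec_pow_prime [Fact p.Prime] (hg : g ∈ group e) (hr : rot g ≠ 0) (x : ZMod p) :
    rot (sec [x] (g ^ p)) = ∑ y, rot (sec [y] g) := by
  have key : ∀ n, rot (sec [x] (g ^ n)) = ∑ i ∈ Finset.range n, rot (sec [x + (i : ZMod p) * rot g] g) := by
    intro n
    induction n with
    | zero => simp [sec_one, rot_one]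
    | succ n ih =>
      rw [sec_pow_succ hg, rot_mul (sec_mem hg _) (sec_mem ((group e).pow_mem hg n) _), ih,
        Finset.sum_range_succ, add_comm]
  rw [key, sum_range_orbit hr x (fun y => rot (sec [y] g))]

theorem IsBExponent.map_sec_pow_prime [Fact p.Prime] {β : TreeAut (ZMod p) → ZMod p}
    (hβ : IsBExponent e β) (hg : g ∈ group e) (hr : rot g ≠ 0) (x : ZMod p) :
    β (sec [x] (g ^ p)) = β g := by
  have key : ∀ n, β (sec [x] (g ^ n)) = ∑ i ∈ Finset.range n, β (sec [x + i * rot g] g) := by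
    intro n
    induction n with
    | zero => simp [sec_one, hβ.map_one]
    | succ n ih =>
      rw [sec_pow_succ hg, hβ.map_mul (sec_mem hg _) (sec_mem ((group e).pow_mem hg n) _), ih,
        Finset.sum_range_succ, add_comm]
  rw [key, sum_range_orbit hr x (fun y => β (sec [y] g)), hβ.sum_sec hg]

theorem sec_pow_of_rot_eq_zero [NeZero p] (hg : g ∈ group e) (hr : rot g = 0) (x : ZMod p)
    (n : ℕ) : sec [x] (g ^ n) = sec [x] g ^ n := by
  induction n with
  | zero => simp [sec_one]
  | succ n ih => rw [pow_succ' (sec [x] g), sec_pow_succ hg, hr, mul_zero, add_zero, ih]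

/-- If the entries of the defining vector have a non-zero sum, the group is not torsion: elements
with non-zero exponents in `a` and in `b` have infinite order. -/
theorem sum_extVec_eq_zero [Fact p.Prime] (he : e ≠ 0) (htors : IsMulTorsion (group e)) :
    ∑ x, extVec e x = 0 := by
  obtain ⟨β, hβ⟩ := exists_isBExponent he
  by_contra hsum
  -- Infinite descent: if g ^ n = 1 then n = p * m, and the section of g ^ p at 0 has exponent m,
  -- the same `β`, and rotation number `β g` times the non-zero sum.
  have key : ∀ n : ℕ, ∀ g ∈ group e, rot g ≠ 0 → β g ≠ 0 → 0 < n → g ^ n ≠ 1 := by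
    intro n
    induction n using Nat.strong_induction_on with
    | _ n ih =>
      intro g hg hr hb hn h1
      have h2 : (n : ZMod p) * rot g = 0 := by rw [← rot_pow hg, h1, rot_one]
      obtain ⟨m, rfl⟩ : p ∣ n :=
        (ZMod.natCast_eq_zero_iff _ _).1 ((mul_eq_zero.1 h2).resolve_right hr)
      have hp := (Fact.out : p.Prime).two_le
      have hm : 0 < m := Nat.pos_of_mul_pos_left hn
      refine ih m (by nlinarith) (sec [0] (g ^ p)) (sec_mem ((group e).pow_mem hg p) 0) ?_ ?_ hm ?_
      · rw [rot_sec_pow_prime hg hr, hβ.sum_rot_sec hg]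
        exact mul_ne_zero hb hsum
      · rwa [hβ.map_sec_pow_prime hg hr]
      · rw [← sec_pow_of_rot_eq_zero ((group e).pow_mem hg p) (rot_pow_prime hg), ← pow_mul, h1,
          sec_one]
  have hab := (group e).mul_mem (rotBy_mem e 1) (b_mem e)
  obtain ⟨n, hn, h1⟩ := isOfFinOrder_iff_pow_eq_one.1 (htors ⟨_, hab⟩)
  refine key n _ hab ?_ ?_ hn (by simpa using congrArg Subtype.val h1)
  · rw [rot_mul (rotBy_mem e 1) (b_mem e), rot_rotBy, rot_b, add_zero]; exact one_ne_zero
  · rw [hβ.map_mul (rotBy_mem e 1) (b_mem e), hβ.map_rotBy, hβ.map_b, zero_add]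
    exact one_ne_zero

/-! ### Word length in b and its distribution among sections -/

/-- `HasLength e n g`: the element `g` is a product of rotations and of `n` letters `b^{±1}`. -/
inductive HasLength (e : Fin (p - 1) → ZMod p) : ℕ → TreeAut (ZMod p) → Prop
  | one : HasLength e 0 1
  | rotBy_mul {n g} (z : ZMod p) : HasLength e n g → HasLength e n (rotBy z * g)
  | b_mul {n g} : HasLength e n g → HasLength e (n + 1) (b e * g)
  | b_inv_mul {n g} : HasLength e n g → HasLength e (n + 1) ((b e)⁻¹ * g)

namespace HasLength

theorem rotBy (e : Fin (p - 1) → ZMod p) (z : ZMod p) : HasLength e 0 (rotBy z) := by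
  simpa using HasLength.one.rotBy_mul z

theorem mul {m n : ℕ} (hg : HasLength e m g) (hh : HasLength e n h) :
    HasLength e (m + n) (g * h) := by
  induction hg with
  | one => simpa using hh
  | rotBy_mul z _ ih => rw [mul_assoc]; exact ih.rotBy_mul z
  | b_mul _ ih => rw [mul_assoc, add_right_comm]; exact ih.b_mul
  | b_inv_mul _ ih => rw [mul_assoc, add_right_comm]; exact ih.b_inv_mul

theorem inv {n : ℕ} (hg : HasLength e n g) : HasLength e n g⁻¹ := by
  induction hg with
  | one => simpa using HasLength.one
  | rotBy_mul z _ ih => rw [mul_inv_rev, ← rotBy_neg]; exact ih.mul (HasLength.rotBy e _)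
  | b_mul _ ih => rw [mul_inv_rev]; exact ih.mul (by simpa using HasLength.one.b_inv_mul)
  | b_inv_mul _ ih => rw [mul_inv_rev, inv_inv]; exact ih.mul (by simpa using HasLength.one.b_mul)

variable [NeZero p]

theorem mem {n : ℕ} (hg : HasLength e n g) : g ∈ group e := by
  induction hg with
  | one => exact Subgroup.one_mem _
  | rotBy_mul z _ ih => exact Subgroup.mul_mem _ (rotBy_mem e z) ih
  | b_mul _ ih => exact Subgroup.mul_mem _ (b_mem e) ih
  | b_inv_mul _ ih => exact Subgroup.mul_mem _ (Subgroup.inv_mem _ (b_mem e)) ih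

theorem exists_of_mem (hg : g ∈ group e) : ∃ n, HasLength e n g :=
  group_induction (P := fun g => ∃ n, HasLength e n g) ⟨0, .one⟩
    (fun z _ _ ⟨n, hn⟩ => ⟨n, hn.rotBy_mul z⟩) (fun _ _ ⟨n, hn⟩ => ⟨n + 1, hn.b_mul⟩)
    (fun _ _ ⟨n, hn⟩ => ⟨n + 1, hn.b_inv_mul⟩) hg

/-- The letters `b^{±1}` of an element are distributed among its first-level sections; if all of
them go to the same section, the element is a power of `b` up to rotations on both sides. -/
theorem sec {n : ℕ} (hg : HasLength e n g) : ∃ f : ZMod p → ℕ,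
    (∀ x, HasLength e (f x) (sec [x] g)) ∧ ∑ x, f x = n ∧ ∀ x, f x = n →
      ∃ j : ℤ, g = GGS.rotBy (x + rot g + 1) * b e ^ j * GGS.rotBy (-(x + 1)) := by
  -- Common treatment of c = b and c = b⁻¹: the new letter goes to the section at the x with x + rot
  -- g = -1. A section at x can receive all n + 1 letters only for this x, and then the left
  -- rotation in the formula for g is trivial, so c merges with the power of b.
  have step : ∀ {n g} (c : TreeAut (ZMod p)) (i : ℤ), g ∈ group e → c ∈ group e → rot c = 0 →
      (∀ x ≠ -1, ∃ z, TreeAut.sec [x] c = GGS.rotBy z) → c = b e ^ i →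
      (∀ {m k}, HasLength e m k → HasLength e (m + 1) (TreeAut.sec [-1] c * k)) →
      (∃ f : ZMod p → ℕ, (∀ x, HasLength e (f x) (TreeAut.sec [x] g)) ∧ ∑ x, f x = n ∧ ∀ x, f x = n →
      ∃ j : ℤ, g = GGS.rotBy (x + rot g + 1) * b e ^ j * GGS.rotBy (-(x + 1))) →
      (∃ f : ZMod p → ℕ, (∀ x, HasLength e (f x) (TreeAut.sec [x] (c * g))) ∧ ∑ x, f x = n + 1 ∧
        ∀ x, f x = n + 1 →
        ∃ j : ℤ, c * g = GGS.rotBy (x + rot (c * g) + 1) * b e ^ j * GGS.rotBy (-(x + 1))) := by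
    rintro n g c i hg hcm hc hc1 hci hc2 ⟨f, hf, hsum, hpow⟩
    refine ⟨fun x => f x + if x = -1 - rot g then 1 else 0, fun x => ?_, ?_, fun x hx => ?_⟩
    · rw [sec_mul_of_mem _ hg]
      dsimp only
      split_ifs with h1
      · rw [h1, sub_add_cancel]; exact hc2 (h1 ▸ hf x)
      · obtain ⟨z, hz⟩ := hc1 (x + rot g) fun h => h1 (by rw [← h]; ring)
        rw [hz]; exact (hf x).rotBy_mul z
    · rw [Finset.sum_add_distrib, hsum]; simp
    · have hle : f x ≤ n := hsum ▸ Finset.single_le_sum (fun _ _ => Nat.zero_le _)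
        (Finset.mem_univ x)
      dsimp only at hx
      split_ifs at hx with h1
      · obtain ⟨j, hj⟩ := hpow x (by omega)
        have h0 : x + rot g + 1 = 0 := by rw [h1]; ring
        refine ⟨i + j, ?_⟩
        rw [rot_mul hcm hg, hc, zero_add]
        rw [h0, rotBy_zero, one_mul] at hj ⊢
        conv_lhs => rw [hj, hci, ← mul_assoc, ← zpow_add]
      · omega
  induction hg with
  | one => exact ⟨fun _ => 0, fun x => by rw [sec_one]; exact .one, by simp, fun x _ =>
      ⟨0, by rw [rot_one, zpow_zero, mul_one, ← rotBy_add, add_zero, add_neg_cancel, rotBy_zero]⟩⟩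
  | @rotBy_mul n g z h ih =>
    obtain ⟨f, hf, hsum, hpow⟩ := ih
    refine ⟨f, fun x => ?_, hsum, fun x hx => ?_⟩
    · rw [sec_rotBy_mul _ _ h.mem]; exact hf x
    · obtain ⟨j, hj⟩ := hpow x hx
      refine ⟨j, ?_⟩
      rw [rot_mul (rotBy_mem e z) h.mem, rot_rotBy,
        show x + (z + rot g) + 1 = z + (x + rot g + 1) by ring, rotBy_add z, mul_assoc, mul_assoc,
        ← mul_assoc (GGS.rotBy (x + rot g + 1)), ← hj]
  | b_mul h ih =>
    refine step (b e) 1 h.mem (b_mem e) (rot_b e) (fun x hx => ⟨_, sec_b_of_ne e hx⟩)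
      (zpow_one _).symm ?_ ih
    rw [sec_b_neg_one]; exact fun h => h.b_mul
  | b_inv_mul h ih =>
    refine step (b e)⁻¹ (-1) h.mem (Subgroup.inv_mem _ (b_mem e))
      (by rw [rot_inv (b_mem e), rot_b, neg_zero])
      (fun x hx => ⟨-_, by rw [sec_b_inv, sec_b_of_ne e hx, rotBy_neg]⟩) (zpow_neg_one _).symm ?_ ih
    rw [sec_b_inv, sec_b_neg_one]; exact fun h => h.b_inv_mul

/-- The section is a product of all sections of g, once each, and their lengths add up to n. -/
theorem sec_pow_prime [Fact p.Prime] {n : ℕ} (hg : HasLength e n g) (hr : rot g ≠ 0)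
    (x : ZMod p) : HasLength e n (TreeAut.sec [x] (g ^ p)) := by
  obtain ⟨f, hf, hsum, -⟩ := hg.sec
  have key : ∀ n, HasLength e (∑ i ∈ Finset.range n, f (x + i * rot g))
      (TreeAut.sec [x] (g ^ n)) := by
    intro n
    induction n with
    | zero => simpa [sec_one] using HasLength.one
    | succ n ih =>
      rw [sec_pow_succ hg.mem, Finset.sum_range_succ, add_comm]
      exact (hf _).mul ih
  have := key p
  rwa [sum_range_orbit hr x f, hsum] at this

end HasLength

end GGS

/-! ### Membership for subgroups mapping onto the abelianisation -/

namespace GGS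

open TreeAut

variable {p : ℕ} {e : Fin (p - 1) → ZMod p} {g h : TreeAut (ZMod p)}
  {H : Subgroup (TreeAut (ZMod p))} {𝒳 : Set (Subgroup (TreeAut (ZMod p)))}

theorem mem_of_finite (h𝒳 : IsWeaklyInductive (group e) 𝒳) (hH : H ≤ group e) [Finite H] :
    H ∈ 𝒳 := by
  refine h𝒳.mem_of_finite_index ⊥ H bot_le hH ⟨?_⟩ h𝒳.bot_mem
  rw [Subgroup.relIndex_bot_left]
  exact Nat.card_pos.ne'

section

variable [NeZero p]

theorem isFiniteRelIndex_levelStab (hH : H ≤ group e) :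
    (H ⊓ levelStab (ZMod p) 1).IsFiniteRelIndex H := by
  let φ : H →* Multiplicative (ZMod p) :=
    { toFun := fun g => Multiplicative.ofAdd (rot g.1)
      map_one' := rfl
      map_mul' := fun g h => by
        rw [Subgroup.coe_mul, rot_mul (hH g.2) (hH h.2), ofAdd_add] }
  have hker : (H ⊓ levelStab (ZMod p) 1).subgroupOf H = φ.ker := by
    ext g
    rw [Subgroup.mem_subgroupOf, MonoidHom.mem_ker, Subgroup.mem_inf,
      ← rot_eq_zero_iff (hH g.2)]
    exact ⟨fun h => congrArg Multiplicative.ofAdd h.2,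
      fun h => ⟨g.2, Multiplicative.ofAdd.injective h⟩⟩
  refine ⟨?_⟩
  rw [Subgroup.relIndex, hker]
  exact Subgroup.FiniteIndex.index_ne_zero

theorem fg_inf_levelStab (hH : H ≤ group e) (hfg : H.FG) : (H ⊓ levelStab (ZMod p) 1).FG := by
  have h1 : Group.FG H := (Group.fg_iff_subgroup_fg H).2 hfg
  have h2 : ((H ⊓ levelStab (ZMod p) 1).subgroupOf H).FiniteIndex :=
    ⟨(isFiniteRelIndex_levelStab hH).relIndex_ne_zero⟩
  have h3 : ((H ⊓ levelStab (ZMod p) 1).subgroupOf H).FG :=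
    (Group.fg_iff_subgroup_fg _).1 inferInstance
  classical
  obtain ⟨S, hS⟩ := h3
  refine ⟨S.image H.subtype, ?_⟩
  rw [Finset.coe_image, ← MonoidHom.map_closure, hS, Subgroup.map_subgroupOf_eq_of_le inf_le_left]

theorem secSubgroup_inf_levelStab (hH : H ≤ group e) (x : ZMod p) :
    secSubgroup (H ⊓ levelStab (ZMod p) 1) [x] = secSubgroup H [x] := by
  ext k
  constructor
  · rintro ⟨g, hg, h⟩
    exact ⟨g, hg.1, h⟩
  · rintro ⟨g, hg, h, h'⟩
    exact ⟨g, ⟨hg, (rot_eq_zero_iff (hH hg)).1 (rot_eq_zero_of_apply_eq (hH hg) h)⟩, h, h'⟩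

theorem fg_secSubgroup_of_le (hH : H ≤ group e) (hfg : H.FG) (x : ZMod p) :
    (secSubgroup H [x]).FG := by
  rw [← secSubgroup_inf_levelStab hH]
  exact fg_secSubgroup (fg_inf_levelStab hH hfg) inf_le_right x

theorem secSubgroup_le (hH : H ≤ group e) (x : ZMod p) : secSubgroup H [x] ≤ group e := by
  rintro _ ⟨g, hg, -, rfl⟩
  exact sec_mem (hH hg) x

theorem sec_mem_secSubgroup_of_rot (hH : H ≤ group e) (hg : g ∈ H) (hr : rot g = 0)
    (x : ZMod p) : sec [x] g ∈ secSubgroup H [x] :=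
  sec_mem_secSubgroup hg (by rw [apply_singleton (hH hg), hr, add_zero])

/-- Condition (C) for the level stabiliser in H, which has the same sections and finite index,
followed by (B'). -/
theorem mem_of_secSubgroup_mem (h𝒳 : IsWeaklyInductive (group e) 𝒳) (hH : H ≤ group e)
    (hfg : H.FG) (hsec : ∀ x, secSubgroup H [x] ∈ 𝒳) : H ∈ 𝒳 := by
  refine h𝒳.mem_of_finite_index _ H inf_le_left hH (isFiniteRelIndex_levelStab hH) ?_
  refine h𝒳.mem_of_sections _ (fg_inf_levelStab hH hfg) (inf_le_inf_right _ hH) fun x => ?_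
  rw [secSubgroup_inf_levelStab hH]
  exact hsec x

end

variable [Fact p.Prime]

theorem exists_conj_secSubgroup (hH : H ≤ group e) (hh : h ∈ H) (hr : rot h ≠ 0)
    (x y : ZMod p) : ∃ k ∈ group e, secSubgroup H [y] = conj k (secSubgroup H [x]) := by
  have h1 := H.pow_mem hh ((y - x) * (rot h)⁻¹).val
  refine ⟨sec [x] (h ^ ((y - x) * (rot h)⁻¹).val), sec_mem (hH h1) x, ?_⟩
  rw [← secSubgroup_apply h1, apply_singleton (hH h1), rot_pow (hH hh), ZMod.natCast_zmod_val,
    mul_assoc, inv_mul_cancel₀ hr, mul_one, add_sub_cancel]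

/-- An element with non-zero rotation number acts transitively on the letters, so all sections are
conjugate in G and one suffices. -/
theorem mem_of_transitive (h𝒳 : IsWeaklyInductive (group e) 𝒳)
    (hconj : ∀ H ∈ 𝒳, ∀ g ∈ group e, conj g H ∈ 𝒳) (hH : H ≤ group e) (hfg : H.FG)
    (hh : h ∈ H) (hr : rot h ≠ 0) (x : ZMod p) (hx : secSubgroup H [x] ∈ 𝒳) : H ∈ 𝒳 := by
  refine mem_of_secSubgroup_mem h𝒳 hH hfg fun y => ?_
  obtain ⟨k, hk, h1⟩ := exists_conj_secSubgroup hH hh hr x y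
  rw [h1]
  exact hconj _ hx k hk

theorem rotBy_mem_of_ne_zero {c : ZMod p} (hc : c ≠ 0) (h : rotBy c ∈ H) (z : ZMod p) :
    rotBy z ∈ H := by
  have h1 := H.pow_mem h (z * c⁻¹).val
  rwa [rotBy_pow, ZMod.natCast_zmod_val, mul_assoc, inv_mul_cancel₀ hc, mul_one] at h1

theorem b_mem_of_zpow_mem {j : ℤ} (hj : (j : ZMod p) ≠ 0) (h : b e ^ j ∈ H) : b e ∈ H := by
  have h1 := H.pow_mem h ((j : ZMod p)⁻¹).val
  have h2 : ((j * (((j : ZMod p)⁻¹).val : ℤ) - 1 : ℤ) : ZMod p) = 0 := by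
    push_cast
    rw [ZMod.natCast_zmod_val, mul_inv_cancel₀ hj, sub_self]
  obtain ⟨q, hq⟩ := (ZMod.intCast_zmod_eq_zero_iff_dvd _ p).1 h2
  rw [← zpow_natCast, ← zpow_mul, show j * (((j : ZMod p)⁻¹).val : ℤ) = 1 + p * q by omega,
    zpow_add, zpow_mul, zpow_natCast, b_pow_eq_one, one_zpow, mul_one, zpow_one] at h1
  exact h1

theorem exists_ne_extVec_ne_zero (he : e ≠ 0) (hsum : ∑ x, extVec e x = 0) :
    ∃ x y, x ≠ y ∧ extVec e x ≠ 0 ∧ extVec e y ≠ 0 := by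
  obtain ⟨x, hx⟩ := exists_extVec_ne_zero he
  by_contra hcon
  push Not at hcon
  refine hx ?_
  rw [← hsum, Finset.sum_eq_single x (fun y _ hy => hcon x y hy.symm hx) (by simp)]

theorem ne_neg_one_of_extVec_ne_zero {x : ZMod p} (hx : extVec e x ≠ 0) : x ≠ -1 := by
  rintro rfl
  exact hx (extVec_neg_one e)

/-- A finitely generated subgroup containing `a` and a conjugate of `b` is in every weakly
inductive class closed under conjugation. -/
theorem mem_of_rotBy_mem (he : e ≠ 0) (hsum : ∑ x, extVec e x = 0)
    (h𝒳 : IsWeaklyInductive (group e) 𝒳) (hconj : ∀ H ∈ 𝒳, ∀ g ∈ group e, conj g H ∈ 𝒳) {n : ℕ}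
    (hg : HasLength e n g) (hH : H ≤ group e) (hfg : H.FG) (ha : ∀ z, rotBy z ∈ H)
    (hb : g⁻¹ * b e * g ∈ H) : H ∈ 𝒳 := by
  induction n using Nat.strong_induction_on generalizing g H with
  | _ n ih =>
    obtain ⟨f, hf, hfsum, hpow⟩ := hg.sec
    have hgm := hg.mem
    -- Rotations have trivial sections, so the sections of H are equal, not merely conjugate.
    have hsecH : ∀ x y, secSubgroup H [x] = secSubgroup H [y] := fun x y => by
      have := secSubgroup_apply (ha (x - y)) [y]
      rwa [rotBy_singleton, add_sub_cancel, sec_rotBy, conj_one] at this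
    have hsecb : ∀ x, (sec [x] g)⁻¹ * sec [x + rot g] (b e) * sec [x] g ∈ secSubgroup H [x] := by
      intro x
      have hx := apply_singleton hgm x
      refine ⟨_, hb, ?_, ?_⟩
      · rw [RelIso.mul_apply, RelIso.mul_apply, hx, b_singleton, inv_apply_of_apply_eq hx]
      · rw [sec_mul, sec_mul, hx, b_singleton, sec_inv_of_apply_eq hx]
    -- The letter that g carries to -1, where the section of b is b itself.
    set x := -1 - rot g with hx
    have hbx : (sec [x] g)⁻¹ * b e * sec [x] g ∈ secSubgroup H [x] := by
      have := hsecb x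
      rwa [hx, sub_add_cancel, sec_b_neg_one, ← hx] at this
    -- The section at y contains a non-trivial rotation conjugated by the section of g at y. Undoing
    -- that conjugation yields all rotations, and the new conjugator of b is the section at x times
    -- the inverse of the section at y, of length f x + f y.
    have descend : ∀ y, extVec e (y + rot g) ≠ 0 → f x + f y < n → H ∈ 𝒳 := by
      intro y hy hlt
      have hk := sec_mem hgm y
      have hL : conj (sec [y] g) (secSubgroup H [y]) ∈ 𝒳 := by
        refine ih _ hlt ((hf x).mul (hf y).inv) (conj_le hk (secSubgroup_le hH y))
          (conj_fg (fg_secSubgroup_of_le hH hfg y) _) ?_ ?_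
        · refine rotBy_mem_of_ne_zero hy (mem_conj.2 ?_)
          rw [← sec_b_of_ne e (ne_neg_one_of_extVec_ne_zero hy)]
          exact hsecb y
        · rw [mem_conj, hsecH y x]
          simpa [mul_assoc] using hbx
      have hy' := hconj _ hL _ ((group e).inv_mem hk)
      rw [conj_conj, inv_mul_cancel, conj_one] at hy'
      exact mem_of_secSubgroup_mem h𝒳 hH hfg fun z => hsecH y z ▸ hy'
    obtain ⟨y₁, y₂, hne, h1, h2⟩ := exists_ne_extVec_ne_zero he hsum
    by_cases hlt1 : f x + f (y₁ - rot g) < n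
    · exact descend _ (by rwa [sub_add_cancel]) hlt1
    by_cases hlt2 : f x + f (y₂ - rot g) < n
    · exact descend _ (by rwa [sub_add_cancel]) hlt2
    -- The three letters are distinct, since e vanishes at -1 but not at y₁ or y₂. With both
    -- descents unavailable this forces f x = n, so g is a power of b times a rotation.
    have hle : f x + (f (y₁ - rot g) + f (y₂ - rot g)) ≤ n := by
      have hx1 : x ≠ y₁ - rot g := fun h =>
        ne_neg_one_of_extVec_ne_zero h1 (sub_left_injective (hx.symm.trans h)).symm
      have hx2 : x ≠ y₂ - rot g := fun h =>
        ne_neg_one_of_extVec_ne_zero h2 (sub_left_injective (hx.symm.trans h)).symm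
      have h12 : y₁ - rot g ≠ y₂ - rot g := fun h => hne (sub_left_injective h)
      rw [← hfsum, ← Finset.sum_pair h12, ← Finset.sum_insert (by simp [hx1, hx2])]
      exact Finset.sum_le_sum_of_subset (Finset.subset_univ _)
    obtain ⟨j, hj⟩ := hpow x (by omega)
    rw [hx, sub_add_cancel, neg_add_cancel, rotBy_zero, one_mul, ← hx] at hj
    have hbH : b e ∈ H := by
      have h3 := H.mul_mem (H.mul_mem (ha (-(x + 1))) hb) (H.inv_mem (ha (-(x + 1))))
      rw [hj] at h3
      convert h3 using 1
      group
    have hHG : H = group e := by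
      refine le_antisymm hH ((Subgroup.closure_le _).2 ?_)
      rintro k (rfl | rfl)
      · exact ha 1
      · exact hbH
    rw [hHG]
    exact h𝒳.self_mem

/-- The section at a letter y with a non-zero entry of e contains a non-trivial rotation coming from
b, and a conjugate of b transported from the section at -1. -/
theorem mem_of_b_mem (he : e ≠ 0) (hsum : ∑ x, extVec e x = 0)
    (h𝒳 : IsWeaklyInductive (group e) 𝒳) (hconj : ∀ H ∈ 𝒳, ∀ g ∈ group e, conj g H ∈ 𝒳)
    (hH : H ≤ group e) (hfg : H.FG) (hh : h ∈ H) (hr : rot h ≠ 0) (hb : b e ∈ H) : H ∈ 𝒳 := by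
  obtain ⟨y, hy⟩ := exists_extVec_ne_zero he
  refine mem_of_transitive h𝒳 hconj hH hfg hh hr y ?_
  obtain ⟨k, hk, h1⟩ := exists_conj_secSubgroup hH hh hr (-1) y
  obtain ⟨n, hn⟩ := HasLength.exists_of_mem hk
  have hsecb := fun x => sec_mem_secSubgroup_of_rot hH hb (rot_b e) x
  refine mem_of_rotBy_mem he hsum h𝒳 hconj hn.inv (secSubgroup_le hH y)
    (fg_secSubgroup_of_le hH hfg y) (rotBy_mem_of_ne_zero hy ?_) ?_
  · rw [← sec_b_of_ne e (ne_neg_one_of_extVec_ne_zero hy)]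
    exact hsecb y
  · have h2 := hsecb (-1)
    rw [sec_b_neg_one] at h2
    rw [h1, mem_conj]
    simpa [mul_assoc] using h2

/-- Subgroups that map onto the abelianisation `ℤ/p × ℤ/p` of the GGS group. -/
structure IsFull (β : TreeAut (ZMod p) → ZMod p) (H : Subgroup (TreeAut (ZMod p))) : Prop where
  exists_rot : ∃ h ∈ H, rot h ≠ 0
  exists_b : ∃ t ∈ H, rot t = 0 ∧ β t ≠ 0

variable {β : TreeAut (ZMod p) → ZMod p}

theorem rot_conj {k : TreeAut (ZMod p)} (hg : g ∈ group e) (hk : k ∈ group e) :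
    rot (k * g * k⁻¹) = rot g := by
  rw [rot_mul ((group e).mul_mem hk hg) ((group e).inv_mem hk), rot_mul hk hg, rot_inv hk]
  ring

theorem exists_rot_ne_zero_and_b_ne_zero (hβ : IsBExponent e β) (hH : H ≤ group e) (hh : h ∈ H)
    (hr : rot h ≠ 0) (hg : g ∈ H) (hb : β g ≠ 0) : ∃ k ∈ H, rot k ≠ 0 ∧ β k ≠ 0 := by
  by_cases h1 : β h = 0
  · by_cases h2 : rot g = 0
    · refine ⟨h * g, H.mul_mem hh hg, ?_, ?_⟩
      · rwa [rot_mul (hH hh) (hH hg), h2, add_zero]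
      · rwa [hβ.map_mul (hH hh) (hH hg), h1, zero_add]
    · exact ⟨g, hg, h2, hb⟩
  · exact ⟨h, hh, hr, h1⟩

/-- Take the section of g ^ p: it keeps `β g`, while its rotation number is a multiple of the sum of
e. -/
theorem exists_b_secSubgroup (hβ : IsBExponent e β) (hsum : ∑ x, extVec e x = 0)
    (hH : H ≤ group e) (hg : g ∈ H) (hr : rot g ≠ 0) (hb : β g ≠ 0) (x : ZMod p) :
    ∃ t ∈ secSubgroup H [x], rot t = 0 ∧ β t ≠ 0 := by
  refine ⟨_, sec_mem_secSubgroup_of_rot hH (H.pow_mem hg p) (rot_pow_prime (hH hg)) x, ?_, ?_⟩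
  · rw [rot_sec_pow_prime (hH hg) hr, hβ.sum_rot_sec (hH hg), hsum, mul_zero]
  · rwa [hβ.map_sec_pow_prime (hH hg) hr]

theorem IsFull.secSubgroup (hβ : IsBExponent e β) (hsum : ∑ x, extVec e x = 0)
    (hH : H ≤ group e) (hfull : IsFull β H) (x : ZMod p) : IsFull β (secSubgroup H [x]) := by
  obtain ⟨⟨h, hh, hr⟩, t, ht, htr, htb⟩ := hfull
  constructor
  · obtain ⟨y, hy⟩ := hβ.exists_rot_sec_ne_zero (hH ht) htb
    obtain ⟨k, hk, h1⟩ := exists_conj_secSubgroup hH hh hr y x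
    rw [h1]
    refine ⟨k * sec [y] t * k⁻¹, ⟨_, sec_mem_secSubgroup_of_rot hH ht htr y, rfl⟩, ?_⟩
    rwa [rot_conj (sec_mem (hH ht) y) hk]
  · obtain ⟨g, hg, hr', hb'⟩ := exists_rot_ne_zero_and_b_ne_zero hβ hH hh hr ht htb
    exact exists_b_secSubgroup hβ hsum hH hg hr' hb' x

/-- Induction on the length of t: a section of t with `β` ≠ 0 is either strictly shorter or shows
that t is conjugate to a power of b. Fullness passes to sections, so the descent can continue. -/
theorem mem_of_isFull_of_hasLength (he : e ≠ 0) (hβ : IsBExponent e β)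
    (hsum : ∑ x, extVec e x = 0)
    (h𝒳 : IsWeaklyInductive (group e) 𝒳) (hconj : ∀ H ∈ 𝒳, ∀ g ∈ group e, conj g H ∈ 𝒳) {n : ℕ}
    {t : TreeAut (ZMod p)} (hlen : HasLength e n t) (hH : H ≤ group e) (hfg : H.FG)
    (hfull : IsFull β H) (ht : t ∈ H) (htr : rot t = 0) (htb : β t ≠ 0) : H ∈ 𝒳 := by
  induction n using Nat.strong_induction_on generalizing t H with
  | _ n ih =>
    obtain ⟨f, hf, hfsum, hpow⟩ := hlen.sec
    obtain ⟨h, hh, hr⟩ := hfull.exists_rot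
    obtain ⟨y, -, hy⟩ := Finset.exists_ne_zero_of_sum_ne_zero ((hβ.sum_sec hlen.mem).symm ▸ htb)
    have hle : f y ≤ n := hfsum ▸ Finset.single_le_sum (fun _ _ => Nat.zero_le _)
      (Finset.mem_univ y)
    obtain hlt | heq := hle.lt_or_eq
    · refine mem_of_transitive h𝒳 hconj hH hfg hh hr y ?_
      have hH' := secSubgroup_le hH y
      have hfg' := fg_secSubgroup_of_le hH hfg y
      have hfull' := hfull.secSubgroup hβ hsum hH y
      have ht' := sec_mem_secSubgroup_of_rot hH ht htr y
      have htm := hH' ht'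
      by_cases hr' : rot (sec [y] t) = 0
      · exact ih _ hlt (hf y) hH' hfg' hfull' ht' hr' hy
      -- The section of t moves the first level, so one more section is taken: that of its p-th
      -- power has rotation number 0, the same `β`, and no more letters.
      · refine mem_of_transitive h𝒳 hconj hH' hfg' ht' hr' 0 ?_
        refine ih _ hlt ((hf y).sec_pow_prime hr' 0) (secSubgroup_le hH' 0)
          (fg_secSubgroup_of_le hH' hfg' 0) (hfull'.secSubgroup hβ hsum hH' 0)
          (sec_mem_secSubgroup_of_rot hH' (Subgroup.pow_mem _ ht' p) (rot_pow_prime htm) 0) ?_ ?_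
        · rw [rot_sec_pow_prime htm hr', hβ.sum_rot_sec htm, hsum, mul_zero]
        · rwa [hβ.map_sec_pow_prime htm hr']
    · obtain ⟨j, hj⟩ := hpow y heq
      rw [htr, add_zero, rotBy_neg] at hj
      have hc := (group e).inv_mem (rotBy_mem e (y + 1))
      -- Otherwise t would be trivial, against `β t ≠ 0`. Since j is invertible modulo p, a
      -- conjugate of H by a rotation contains b.
      have hj0 : (j : ZMod p) ≠ 0 := by
        intro h0
        obtain ⟨q, rfl⟩ := (ZMod.intCast_zmod_eq_zero_iff_dvd _ p).1 h0
        rw [zpow_mul, zpow_natCast, b_pow_eq_one, one_zpow, mul_one, mul_inv_cancel] at hj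
        exact htb (by rw [hj, hβ.map_one])
      have hbj : b e ^ j ∈ conj (rotBy (y + 1))⁻¹ H := by
        rw [mem_conj, inv_inv, ← hj]
        exact ht
      have hL := mem_of_b_mem he hsum h𝒳 hconj (conj_le hc hH) (conj_fg hfg _)
        (h := (rotBy (y + 1))⁻¹ * h * (rotBy (y + 1))⁻¹⁻¹) ⟨h, hh, rfl⟩
        (by rwa [rot_conj (hH hh) hc]) (b_mem_of_zpow_mem hj0 hbj)
      have := hconj _ hL _ (rotBy_mem e (y + 1))
      rwa [conj_conj, mul_inv_cancel, conj_one] at this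

theorem mem_of_isFull (he : e ≠ 0) (hβ : IsBExponent e β) (hsum : ∑ x, extVec e x = 0)
    (h𝒳 : IsWeaklyInductive (group e) 𝒳) (hconj : ∀ H ∈ 𝒳, ∀ g ∈ group e, conj g H ∈ 𝒳)
    (hH : H ≤ group e) (hfg : H.FG) (hfull : IsFull β H) : H ∈ 𝒳 := by
  obtain ⟨t, ht, htr, htb⟩ := hfull.exists_b
  obtain ⟨n, hn⟩ := HasLength.exists_of_mem (hH ht)
  exact mem_of_isFull_of_hasLength he hβ hsum h𝒳 hconj hn hH hfg hfull ht htr htb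

/-- For a subgroup `H` transitive on the first level, either a second section of `H` maps onto the
abelianisation, or one of the first two iterated sections fixes the first level. -/
theorem isFull_secSubgroup_secSubgroup (hβ : IsBExponent e β) (hsum : ∑ x, extVec e x = 0)
    (hH : H ≤ group e) (hh : h ∈ H) (hr : rot h ≠ 0)
    (h1 : ∃ k ∈ secSubgroup H [0], rot k ≠ 0)
    (h2 : ∃ k ∈ secSubgroup (secSubgroup H [0]) [0], rot k ≠ 0) :
    IsFull β (secSubgroup (secSubgroup H [0]) [0]) := by
  refine ⟨h2, ?_⟩
  obtain ⟨k, hk, hkr⟩ := h1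
  have hH' := secSubgroup_le hH 0
  obtain ⟨s, hs, hs0, hsk⟩ := hk
  have hsr := rot_eq_zero_of_apply_eq (hH hs) hs0
  -- A rotation in a section of s is a combination of the exponents of b in all sections of s, so
  -- these cannot all vanish.
  obtain ⟨y, hy⟩ : ∃ y, β (sec [y] s) ≠ 0 := by
    by_contra hcon
    push Not at hcon
    rw [← hsk, hβ.rot_sec_eq_sum (hH hs)] at hkr
    simp [hcon] at hkr
  obtain ⟨l, hl, hconj⟩ := exists_conj_secSubgroup hH hh hr y 0
  have hm : l * sec [y] s * l⁻¹ ∈ secSubgroup H [0] := by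
    rw [hconj]
    exact ⟨_, sec_mem_secSubgroup_of_rot hH hs hsr y, rfl⟩
  obtain ⟨g, hg, hgr, hgb⟩ := exists_rot_ne_zero_and_b_ne_zero hβ hH' ⟨s, hs, hs0, hsk⟩ hkr hm
    (by rwa [hβ.map_conj (sec_mem (hH hs) y) hl])
  exact exists_b_secSubgroup hβ hsum hH' hg hgr hgb 0

end GGS

/-! ### Induction on the number of edges labelled b -/

namespace GGS

open TreeAut

variable {p : ℕ} {e : Fin (p - 1) → ZMod p} {g : TreeAut (ZMod p)}
  {𝒳 : Set (Subgroup (TreeAut (ZMod p)))} {V : Type*} {E : V → TreeAut (ZMod p) → V → Prop}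
  {B : Set (V × V)} {v : V}

/-- The labels of the graph are rotations, or `b` on edges in the given set `B`. -/
def LabelBound (e : Fin (p - 1) → ZMod p) (E : V → TreeAut (ZMod p) → V → Prop)
    (B : Set (V × V)) : Prop :=
  ∀ u g w, E u g w → (∃ z, g = rotBy z) ∨ (g = b e ∧ (u, w) ∈ B)

theorem LabelBound.componentGraph (hE : LabelBound e E B) (v : V) :
    LabelBound e (componentGraph E v) {q ∈ B | ∃ k, Walk E v k q.1} := by
  rintro u g w ⟨h, k, hk⟩
  exact (hE u g w h).imp_right fun h1 => ⟨h1.1, h1.2, k, hk⟩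

variable [Fact p.Prime]

theorem LabelBound.mem_group (hE : LabelBound e E B) {u : V} (hw : Walk E v g u) :
    g ∈ group e := by
  have key : ∀ u g w, E u g w → g ∈ group e := by
    intro u g w h
    obtain ⟨z, rfl⟩ | ⟨rfl, -⟩ := hE u g w h
    · exact rotBy_mem e z
    · exact b_mem e
  induction hw with
  | refl => exact Subgroup.one_mem _
  | fwd _ he ih => exact Subgroup.mul_mem _ (key _ _ _ he) ih
  | bwd _ he ih => exact Subgroup.mul_mem _ (Subgroup.inv_mem _ (key _ _ _ he)) ih

/-- Only the lift over the letter -1 of an edge labelled b is again labelled b, so the bound on such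
edges does not grow. -/
theorem LabelBound.sectionGraph (hE : LabelBound e E B) :
    LabelBound e (sectionGraph E) ((fun q : V × V => ((q.1, -1), (q.2, -1))) '' B) := by
  rintro ⟨u, x⟩ _ ⟨w, y⟩ ⟨g, h, hxy, rfl⟩
  dsimp only at h hxy ⊢
  obtain ⟨z, rfl⟩ | ⟨rfl, hB⟩ := hE u g w h
  · exact Or.inl ⟨0, by rw [sec_rotBy, rotBy_zero]⟩
  · by_cases hx : x = -1
    · rw [b_singleton] at hxy
      obtain rfl : x = y := by simpa using hxy
      exact Or.inr ⟨by rw [hx, sec_b_neg_one], (u, w), hB, by rw [hx]⟩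
    · exact Or.inl ⟨_, sec_b_of_ne e hx⟩

/-- Every letter b along a walk is met when the accumulated rotation carries x to -1; between two
such letters the rotations cancel, so all letters merge into one power. -/
theorem walk_eq_of_forall_reachable (hE : LabelBound e E B)
    (hs : vertexGroup E v ≤ levelStab (ZMod p) 1) {x : ZMod p}
    (hx : ∀ q ∈ B, ∃ k, Walk (sectionGraph E) (v, x) k (q.1, -1)) {u : V} (hw : Walk E v g u) :
    ∃ j : ℤ, g = rotBy (x + rot g + 1) * b e ^ j * rotBy (-(x + 1)) := by
  -- Two walks from v to u differ by a closed walk, which fixes the first level, so the rotation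
  -- number depends only on u; reachability of (u, -1) from (v, x) then fixes its value.
  have hrot : ∀ {u w g}, (u, w) ∈ B → Walk E v g u → x + rot g + 1 = 0 := by
    intro u w g hB hg
    obtain ⟨k, hk⟩ := hx _ hB
    obtain ⟨g', hg', hgx, -⟩ := walk_sectionGraph.1 hk
    have hgm := hE.mem_group hg
    have hgm' := hE.mem_group hg'
    have h1 : g⁻¹ * g' ∈ vertexGroup E v := hg'.trans hg.symm
    have h2 := (rot_eq_zero_iff ((group e).mul_mem ((group e).inv_mem hgm) hgm')).2 (hs h1)
    rw [rot_mul ((group e).inv_mem hgm) hgm', rot_inv hgm] at h2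
    rw [apply_singleton hgm'] at hgx
    have h3 : x + rot g' = -1 := by simpa using hgx
    linear_combination h3 - h2
  have hrotBy : ∀ {g} (z : ZMod p), g ∈ group e →
      (∃ j : ℤ, g = rotBy (x + rot g + 1) * b e ^ j * rotBy (-(x + 1))) →
      ∃ j : ℤ, rotBy z * g =
        rotBy (x + rot (rotBy z * g) + 1) * b e ^ j * rotBy (-(x + 1)) := by
    rintro g z hg ⟨j, hj⟩
    refine ⟨j, ?_⟩
    rw [rot_mul (rotBy_mem e z) hg, rot_rotBy,
      show x + (z + rot g) + 1 = z + (x + rot g + 1) by ring, rotBy_add z, mul_assoc, mul_assoc,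
      ← mul_assoc (rotBy (x + rot g + 1)), ← hj]
  induction hw with
  | refl =>
    exact ⟨0, by rw [rot_one, zpow_zero, mul_one, ← rotBy_add, add_zero, add_neg_cancel, rotBy_zero]⟩
  | @fwd g l u w h1 hl ih =>
    obtain ⟨z, rfl⟩ | ⟨rfl, hB⟩ := hE _ _ _ hl
    · exact hrotBy z (hE.mem_group h1) ih
    · obtain ⟨j, hj⟩ := ih
      have h0 := hrot hB h1
      refine ⟨1 + j, ?_⟩
      rw [rot_mul (b_mem e) (hE.mem_group h1), rot_b, zero_add]
      rw [h0, rotBy_zero, one_mul] at hj ⊢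
      rw [zpow_add, zpow_one, mul_assoc, ← hj]
  | @bwd g l u w h1 hl ih =>
    obtain ⟨z, rfl⟩ | ⟨rfl, hB⟩ := hE _ _ _ hl
    · rw [← rotBy_neg]
      exact hrotBy _ (hE.mem_group h1) ih
    · obtain ⟨j, hj⟩ := ih
      have h0 := hrot hB (h1.bwd hl)
      have h2 : rot ((b e)⁻¹ * g) = rot g := by
        rw [rot_mul ((group e).inv_mem (b_mem e)) (hE.mem_group h1), rot_inv (b_mem e), rot_b,
          neg_zero, zero_add]
      rw [h2] at h0
      refine ⟨-1 + j, ?_⟩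
      rw [h2]
      rw [h0, rotBy_zero, one_mul] at hj ⊢
      rw [zpow_add, zpow_neg_one, mul_assoc, ← hj]

theorem finite_zpowers_b (e : Fin (p - 1) → ZMod p) : Finite (Subgroup.zpowers (b e)) :=
  finite_zpowers.2 (isOfFinOrder_iff_pow_eq_one.2 ⟨p, (Fact.out : p.Prime).pos, b_pow_eq_one e⟩)

theorem finite_vertexGroup_of_forall_reachable (hE : LabelBound e E B)
    (hs : vertexGroup E v ≤ levelStab (ZMod p) 1) {x : ZMod p}
    (hx : ∀ q ∈ B, ∃ k, Walk (sectionGraph E) (v, x) k (q.1, -1)) : Finite (vertexGroup E v) := by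
  have hle : vertexGroup E v ≤ conj (rotBy (x + 1)) (Subgroup.zpowers (b e)) := by
    intro g hg
    obtain ⟨j, hj⟩ := walk_eq_of_forall_reachable hE hs hx hg
    rw [(rot_eq_zero_iff (hE.mem_group hg)).2 (hs hg), add_zero, rotBy_neg] at hj
    exact ⟨b e ^ j, Subgroup.zpow_mem_zpowers _ _, hj.symm⟩
  have := finite_zpowers_b e
  have : Finite (conj (rotBy (x + 1)) (Subgroup.zpowers (b e))) :=
    Set.Finite.image _ (Set.toFinite (Subgroup.zpowers (b e) : Set (TreeAut (ZMod p))))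
  exact Finite.of_injective _ (Subgroup.inclusion_injective hle)

/-- Groups of closed walks in a labelled graph with finitely many edges labelled `b` belong to
every weakly inductive class closed under conjugation. -/
theorem vertexGroup_mem (he : e ≠ 0) (hsum : ∑ x, extVec e x = 0)
    (h𝒳 : IsWeaklyInductive (group e) 𝒳) (hconj : ∀ H ∈ 𝒳, ∀ g ∈ group e, conj g H ∈ 𝒳) (n : ℕ) :
    ∀ (V : Type) (E : V → TreeAut (ZMod p) → V → Prop) (B : Set (V × V)) (v : V), B.Finite →
      B.ncard ≤ n → LabelBound e E B → (vertexGroup E v).FG → vertexGroup E v ∈ 𝒳 := by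
  obtain ⟨β, hβ⟩ := exists_isBExponent he
  induction n using Nat.strong_induction_on with
  | _ n ih =>
    -- Stated for at most n edges because it is also applied to first and second sections, where the
    -- count need not drop.
    have hstab : ∀ (V : Type) (E : V → TreeAut (ZMod p) → V → Prop) (B : Set (V × V)) (v : V),
        B.Finite → B.ncard ≤ n → LabelBound e E B → (vertexGroup E v).FG →
        vertexGroup E v ≤ levelStab (ZMod p) 1 → vertexGroup E v ∈ 𝒳 := by
      intro V E B v hfin hcard hE hfg hs
      have hH : vertexGroup E v ≤ group e := fun g hg => hE.mem_group hg
      by_cases hex : ∃ x : ZMod p, ∀ q ∈ B, ∃ k, Walk (sectionGraph E) (v, x) k (q.1, -1)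
      · obtain ⟨x, hx⟩ := hex
        have := finite_vertexGroup_of_forall_reachable hE hs hx
        exact mem_of_finite h𝒳 hH
      -- For every x, some b-edge has its b-lift outside the component of (v, x), so restricting to
      -- that component lowers the count.
      · refine mem_of_secSubgroup_mem h𝒳 hH hfg fun x => ?_
        have hfgx := fg_secSubgroup_of_le hH hfg x
        rw [← vertexGroup_sectionGraph, ← vertexGroup_componentGraph] at hfgx ⊢
        have hbound := hE.sectionGraph.componentGraph (v, x)
        set ι : V × V → (V × ZMod p) × (V × ZMod p) := fun q => ((q.1, -1), (q.2, -1)) with hι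
        have hset : {q ∈ ι '' B | ∃ k, Walk (sectionGraph E) (v, x) k q.1} ⊆
            ι '' {q ∈ B | ∃ k, Walk (sectionGraph E) (v, x) k (q.1, -1)} := by
          rintro _ ⟨⟨q, hq, rfl⟩, hk⟩
          exact ⟨q, ⟨hq, hk⟩, rfl⟩
        have hlt : {q ∈ B | ∃ k, Walk (sectionGraph E) (v, x) k (q.1, -1)}.ncard < B.ncard := by
          refine Set.ncard_lt_ncard ⟨Set.sep_subset _ _, fun hsub => hex ⟨x, fun q hq => ?_⟩⟩ hfin
          exact (hsub hq).2
        have hfin' := hfin.subset (Set.sep_subset B fun q =>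
          ∃ k, Walk (sectionGraph E) (v, x) k (q.1, -1))
        have hle := (Set.ncard_le_ncard hset (hfin'.image ι)).trans
          (Set.ncard_image_le hfin')
        exact ih _ (hle.trans_lt (hlt.trans_le hcard)) _ _ _ _ ((hfin'.image ι).subset hset)
          le_rfl hbound hfgx
    intro V E B v hfin hcard hE hfg
    have hH : vertexGroup E v ≤ group e := fun g hg => hE.mem_group hg
    have not_le : ∀ {H}, H ≤ group e → ¬ H ≤ levelStab (ZMod p) 1 → ∃ h ∈ H, rot h ≠ 0 := by
      intro H hH hn
      obtain ⟨h, hh, hn⟩ := SetLike.not_le_iff_exists.1 hn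
      exact ⟨h, hh, fun h0 => hn ((rot_eq_zero_iff (hH hh)).1 h0)⟩
    by_cases hs : vertexGroup E v ≤ levelStab (ZMod p) 1
    · exact hstab V E B v hfin hcard hE hfg hs
    obtain ⟨h, hh, hr⟩ := not_le hH hs
    refine mem_of_transitive h𝒳 hconj hH hfg hh hr 0 ?_
    have hH' := secSubgroup_le hH 0
    have hfg' := fg_secSubgroup_of_le hH hfg 0
    by_cases hs' : secSubgroup (vertexGroup E v) [0] ≤ levelStab (ZMod p) 1
    · rw [← vertexGroup_sectionGraph] at hs' hfg' ⊢
      exact hstab _ _ _ _ (hfin.image _) ((Set.ncard_image_le hfin).trans hcard) hE.sectionGraph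
        hfg' hs'
    obtain ⟨h', hh', hr'⟩ := not_le hH' hs'
    refine mem_of_transitive h𝒳 hconj hH' hfg' hh' hr' 0 ?_
    have hH₂ := secSubgroup_le hH' 0
    have hfg₂ := fg_secSubgroup_of_le hH' hfg' 0
    by_cases hs₂ : secSubgroup (secSubgroup (vertexGroup E v) [0]) [0] ≤ levelStab (ZMod p) 1
    · rw [← vertexGroup_sectionGraph, ← vertexGroup_sectionGraph] at hs₂ hfg₂ ⊢
      exact hstab _ _ _ _ ((hfin.image _).image _) ((Set.ncard_image_le (hfin.image _)).trans
        ((Set.ncard_image_le hfin).trans hcard)) hE.sectionGraph.sectionGraph hfg₂ hs₂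
    exact mem_of_isFull he hβ hsum h𝒳 hconj hH₂ hfg₂
      (isFull_secSubgroup_secSubgroup hβ hsum hH hh hr ⟨h', hh', hr'⟩ (not_le hH₂ hs₂))

/-! ### Finitely generated subgroups as groups of closed walks -/

/-- Part of the Cayley graph of the GGS group, with the edges labelled `b` starting in `F` only,
and with additional edges labelled `1` from `1` to the elements of `S`. -/
def foldedCayleyGraph (e : Fin (p - 1) → ZMod p) (S F : Set (TreeAut (ZMod p))) :
    TreeAut (ZMod p) → TreeAut (ZMod p) → TreeAut (ZMod p) → Prop :=
  fun u g w => (∃ z, g = rotBy z ∧ w = g * u) ∨ (g = b e ∧ u ∈ F ∧ w = g * u) ∨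
    (g = 1 ∧ u = 1 ∧ w ∈ S)

theorem labelBound_foldedCayleyGraph (S F : Set (TreeAut (ZMod p))) :
    LabelBound e (foldedCayleyGraph e S F) ((fun u => (u, b e * u)) '' F) := by
  rintro u g w (⟨z, rfl, -⟩ | ⟨rfl, hu, rfl⟩ | ⟨rfl, -, -⟩)
  · exact Or.inl ⟨z, rfl⟩
  · exact Or.inr ⟨rfl, u, hu, rfl⟩
  · exact Or.inl ⟨0, rotBy_zero.symm⟩

/-- F collects the sources of the b-edges used in spelling g. Allowing any larger set makes it
possible to unite the sets of several generators. -/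
theorem exists_finite_walk (hg : g ∈ group e) : ∃ F : Set (TreeAut (ZMod p)), F.Finite ∧
    ∀ S F', F ⊆ F' → Walk (foldedCayleyGraph e S F') 1 g g := by
  refine group_induction (P := fun g => ∃ F : Set (TreeAut (ZMod p)), F.Finite ∧
    ∀ S F', F ⊆ F' → Walk (foldedCayleyGraph e S F') 1 g g) ?_ ?_ ?_ ?_ hg
  · exact ⟨∅, Set.finite_empty, fun _ _ _ => .refl⟩
  · rintro z g - ⟨F, hF, hw⟩
    exact ⟨F, hF, fun S F' hF' => (hw S F' hF').fwd (Or.inl ⟨z, rfl, rfl⟩)⟩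
  · rintro g - ⟨F, hF, hw⟩
    refine ⟨insert g F, hF.insert g, fun S F' hF' => ?_⟩
    exact (hw S F' ((Set.subset_insert _ _).trans hF')).fwd
      (Or.inr (Or.inl ⟨rfl, hF' (Set.mem_insert _ _), rfl⟩))
  · rintro g - ⟨F, hF, hw⟩
    refine ⟨insert ((b e)⁻¹ * g) F, hF.insert _, fun S F' hF' => ?_⟩
    exact (hw S F' ((Set.subset_insert _ _).trans hF')).bwd
      (Or.inr (Or.inl ⟨rfl, hF' (Set.mem_insert _ _), by rw [mul_inv_cancel_left]⟩))

theorem exists_vertexGroup_eq {H : Subgroup (TreeAut (ZMod p))} (hH : H ≤ group e)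
    (hfg : H.FG) : ∃ (E : TreeAut (ZMod p) → TreeAut (ZMod p) → TreeAut (ZMod p) → Prop)
      (B : Set (TreeAut (ZMod p) × TreeAut (ZMod p))), B.Finite ∧ LabelBound e E B ∧
        vertexGroup E 1 = H := by
  obtain ⟨S, rfl⟩ := hfg
  have hex : ∀ s : S, ∃ F : Set (TreeAut (ZMod p)), F.Finite ∧
      ∀ S F', F ⊆ F' → Walk (foldedCayleyGraph e S F') 1 s.1 s.1 :=
    fun s => exists_finite_walk (hH (Subgroup.subset_closure s.2))
  choose F hF hw using hex
  refine ⟨foldedCayleyGraph e S (⋃ s, F s), _, (Set.finite_iUnion hF).image _,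
    labelBound_foldedCayleyGraph _ _, le_antisymm ?_ ((Subgroup.closure_le _).2 ?_)⟩
  · have hedge : ∀ {u g w}, foldedCayleyGraph e S (⋃ s, F s) u g w →
        w⁻¹ * g * u ∈ Subgroup.closure (S : Set (TreeAut (ZMod p))) := by
      rintro u g w (⟨z, -, rfl⟩ | ⟨-, -, rfl⟩ | ⟨rfl, rfl, hw⟩)
      · simp [mul_assoc]
      · simp [mul_assoc]
      · simpa using Subgroup.subset_closure hw
    have key : ∀ {g w}, Walk (foldedCayleyGraph e S (⋃ s, F s)) 1 g w →
        w⁻¹ * g ∈ Subgroup.closure (S : Set (TreeAut (ZMod p))) := by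
      intro g w h
      induction h with
      | refl => simp
      | fwd _ he ih => simpa [mul_assoc] using Subgroup.mul_mem _ (hedge he) ih
      | bwd _ he ih =>
        simpa [mul_assoc] using Subgroup.mul_mem _ (Subgroup.inv_mem _ (hedge he)) ih
    intro g hg
    simpa using key hg
  · intro s hs
    -- The walk spelling s from 1 to s, closed up by the added edge with label 1, is a loop with
    -- label s.
    have h1 := hw ⟨s, hs⟩ S _ (Set.subset_iUnion F ⟨s, hs⟩)
    have h2 : Walk (foldedCayleyGraph e S (⋃ s, F s)) 1 1 s :=
      Walk.single (Or.inr (Or.inr ⟨rfl, rfl, hs⟩))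
    simpa [mem_vertexGroup] using (h2.trans h1.symm).symm

theorem hasStrongSubgroupInduction_group (he : e ≠ 0) (hsum : ∑ x, extVec e x = 0) :
    HasStrongSubgroupInduction (group e) := by
  refine ⟨isSelfSimilar_group e, fun 𝒳 h𝒳 H hH hfg => ?_⟩
  have hcore := h𝒳.conj_core fun g hg x => sec_mem hg x
  obtain ⟨E, B, hB, hE, rfl⟩ := exists_vertexGroup_eq hH hfg
  have := vertexGroup_mem he hsum hcore (fun H hH g hg k hk => by
    rw [conj_conj]
    exact hH _ ((group e).mul_mem hk hg)) _ _ E B 1 hB le_rfl hE hfg 1 (group e).one_mem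
  rwa [conj_one] at this

end GGS

theorem theoremC (p : ℕ) [Fact p.Prime] (hp : Odd p) (e : Fin (p - 1) → ZMod p) (he : e ≠ 0)
    (htors : IsMulTorsion (GGS.group e)) :
    TreeAut.HasStrongSubgroupInduction (GGS.group e) ∧
      TreeAut.HasSubgroupInduction (GGS.group e) := by
  have h := GGS.hasStrongSubgroupInduction_group he (GGS.sum_extVec_eq_zero he htors)
  exact ⟨h, h.1, fun 𝒳 h𝒳 => h.2 𝒳 h𝒳.toIsWeaklyInductive⟩
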